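/- **Lemma (Scaling).** Let $\alpha,\beta>0$, $\mu_{max}=\sqrt{(\alpha^2+\beta^2)/2}$, $\mu\in(0,\mu_{max})$ and $t,x_1,x_2\in\mathbb R$. Put $\Delta=\alpha^2+\beta^2-2\mu^2>0$, $y_1=x+(\alpha^2-3\beta^2)t+x_1$, $y_2=x+(3\alpha^2-\beta^2)t+x_2$, and $$G=\frac{\beta\sqrt{\alpha^2+\beta^2}}{\alpha\sqrt{\Delta}}\sin(\alpha y_1)-\frac{\sqrt2\,\mu\beta[\cosh(\beta y_2)+\sinh(\beta y_2)]}{\Delta},\qquad F=\cosh(\beta y_2)-\frac{\sqrt2\,\mu\beta[\alpha\cos(\alpha y_1)-\beta\sin(\alpha y_1)]}{\alpha\sqrt{\alpha^2+\beta^2}\sqrt{\Delta}}.$$ Let $$B_\mu(t,x)=2\sqrt2\,\partial_x\Big[\arctan\frac{G}{F}\Big]$$ be the Gardner breather, where at zeros of $F$ the derivative is understood as its smooth extension $\frac{G_xF-GF_x}{F^2+G^2}$. Let $\Lambda_\alpha B_\mu=\partial_\alpha B_\mu$ and $\Lambda_\beta B_\mu=\partial_\beta B_\mu$ (all other parameters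 and $t,x$ fixed). Put $$V_\mu=5B_{\mu,x}^2+10B_\mu B_{\mu,xx}+\tfrac{15}{2}B_\mu^4-6(\beta^2-\alpha^2)B_\mu^2+3\mu\Big[10B_\mu^3-4(\beta^2-\alpha^2)B_\mu+\tfrac{10}{3}B_{\mu,xx}+10\mu B_\mu^2\Big],$$ $$\mathcal L_\mu[z]=z_{xxxx}-2(\beta^2-\alpha^2)z_{xx}+(\alpha^2+\beta^2)^2z+5B_\mu^2z_{xx}+10B_\mu B_{\mu,x}z_x+10\mu B_\mu z_{xx}+10\mu B_{\mu,x}z_x+V_\mu z,$$ and let $\mathcal Q_\mu$ be the associated quadratic form on $H^2(\mathbb R)$, $$\mathcal Q_\mu[z]=\int_{\mathbb R}z_{xx}^2+\big(2(\beta^2-\alpha^2)-5B_\mu^2-10\mu B_\mu\big)z_x^2+\big((\alpha^2+\beta^2)^2+V_\mu\big)z^2 .$$ A nonzero $z\in H^2(\mathbb R)$ is called a positive (negative) direction for $\mathcal Q_\mu$ if $\mathcal Q_\mu[z]>0$ ($<0$). Then $B_\mu$ is differentiable in $\alpha$ and in $\beta$, the functions $\Lambda_\alpha B_\mu$ and $\Lambda_\beta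 B_\mu$ are smooth in $x$ and belong to $H^2(\mathbb R)$, the integrals below converge absolutely, and $$\mathcal Q_\mu[\Lambda_\alpha B_\mu]=\int_{\mathbb R}\Lambda_\alpha B_\mu\,\mathcal L_\mu[\Lambda_\alpha B_\mu]=32\alpha^2\beta\Big[1+\frac{2\mu^2\Delta}{\Delta^2+8\mu^2\beta^2}\Big]>0,$$ $$\mathcal Q_\mu[\Lambda_\beta B_\mu]=\int_{\mathbb R}\Lambda_\beta B_\mu\,\mathcal L_\mu[\Lambda_\beta B_\mu]=-16\beta\Big[(\alpha^2-\beta^2)+(\alpha^2+\beta^2+2\mu^2)\Big(\frac{\Delta^2+2\mu^2\Delta+4\mu^2\beta^2}{\Delta^2+8\mu^2\beta^2}\Big)\Big]<0 .$$ In particular $\Lambda_\alpha B_\mu$ is a positive direction and $\Lambda_\beta B_\mu$ is a negative direction for $\mathcal Q_\mu$. -/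

import Mathlib

open MeasureTheory
open scoped ContDiff

noncomputable section

/-- `Δ = α² + β² - 2μ²`. -/
def gardnerDelta (α β μ : ℝ) : ℝ := α ^ 2 + β ^ 2 - 2 * μ ^ 2

/-- The largest admissible value of `μ`, at which `Δ` vanishes. -/
def gardnerMuMax (α β : ℝ) : ℝ := Real.sqrt ((α ^ 2 + β ^ 2) / 2)

/-- `y₁ = x + δ t + x₁` with `δ = α² - 3β²`. -/
def gardnerY₁ (α β t x₁ x : ℝ) : ℝ := x + (α ^ 2 - 3 * β ^ 2) * t + x₁

/-- `y₂ = x + γ t + x₂` with `γ = 3α² - β²`. -/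
def gardnerY₂ (α β t x₂ x : ℝ) : ℝ := x + (3 * α ^ 2 - β ^ 2) * t + x₂

/-- The numerator `G_μ` of the Gardner breather. -/
def gardnerG (α β μ t x₁ x₂ x : ℝ) : ℝ :=
  β * Real.sqrt (α ^ 2 + β ^ 2) / (α * Real.sqrt (gardnerDelta α β μ)) *
      Real.sin (α * gardnerY₁ α β t x₁ x)
    - Real.sqrt 2 * μ * β *
      (Real.cosh (β * gardnerY₂ α β t x₂ x) + Real.sinh (β * gardnerY₂ α β t x₂ x)) /
      gardnerDelta α β μ

/-- The denominator `F_μ` of the Gardner breather. -/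
def gardnerF (α β μ t x₁ x₂ x : ℝ) : ℝ :=
  Real.cosh (β * gardnerY₂ α β t x₂ x)
    - Real.sqrt 2 * μ * β *
      (α * Real.cos (α * gardnerY₁ α β t x₁ x) - β * Real.sin (α * gardnerY₁ α β t x₁ x)) /
      (α * Real.sqrt (α ^ 2 + β ^ 2) * Real.sqrt (gardnerDelta α β μ))

/-- The Gardner breather `B_μ = 2√2 ∂ₓ arctan (G_μ / F_μ)`. The derivative is written out as
`(∂ₓG F - G ∂ₓF) / (F² + G²)`, which is the smooth extension of `∂ₓ arctan (G / F)` through the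
points where `F` vanishes; see `gardnerBreather_eq_deriv_arctan`. -/
def gardnerBreather (α β μ t x₁ x₂ x : ℝ) : ℝ :=
  2 * Real.sqrt 2 *
    ((deriv (gardnerG α β μ t x₁ x₂) x * gardnerF α β μ t x₁ x₂ x
        - gardnerG α β μ t x₁ x₂ x * deriv (gardnerF α β μ t x₁ x₂) x) /
      (gardnerF α β μ t x₁ x₂ x ^ 2 + gardnerG α β μ t x₁ x₂ x ^ 2))

theorem gardnerBreather_eq_deriv_arctan (α β μ t x₁ x₂ x : ℝ)
    (hF : gardnerF α β μ t x₁ x₂ x ≠ 0) :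
    gardnerBreather α β μ t x₁ x₂ x =
      2 * Real.sqrt 2 *
        deriv (fun y => Real.arctan (gardnerG α β μ t x₁ x₂ y / gardnerF α β μ t x₁ x₂ y)) x := by
  have hG' : DifferentiableAt ℝ (gardnerG α β μ t x₁ x₂) x := by
    unfold gardnerG gardnerY₁ gardnerY₂; fun_prop
  have hF' : DifferentiableAt ℝ (gardnerF α β μ t x₁ x₂) x := by
    unfold gardnerF gardnerY₁ gardnerY₂; fun_prop
  have h := ((hG'.hasDerivAt.div hF'.hasDerivAt hF).arctan).deriv
  have h' : deriv (fun y => Real.arctan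
      (gardnerG α β μ t x₁ x₂ y / gardnerF α β μ t x₁ x₂ y)) x = _ := h
  rw [h', gardnerBreather]
  have h2 : 0 < gardnerF α β μ t x₁ x₂ x ^ 2 + gardnerG α β μ t x₁ x₂ x ^ 2 := by positivity
  have h3 : gardnerF α β μ t x₁ x₂ x ^ 2 + gardnerG α β μ t x₁ x₂ x ^ 2 ≠ 0 := h2.ne'
  simp only [Pi.div_apply]
  field_simp

/-- The scaling direction `Λ_α B_μ = ∂_α B_μ`, with `β, μ, t, x₁, x₂` held fixed, as a function
of `x`. -/
def scalingAlpha (α β μ t x₁ x₂ : ℝ) : ℝ → ℝ :=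
  fun x => deriv (fun a => gardnerBreather a β μ t x₁ x₂ x) α

/-- The scaling direction `Λ_β B_μ = ∂_β B_μ`, with `α, μ, t, x₁, x₂` held fixed, as a function
of `x`. -/
def scalingBeta (α β μ t x₁ x₂ : ℝ) : ℝ → ℝ :=
  fun x => deriv (fun b => gardnerBreather α b μ t x₁ x₂ x) β

/-- The potential, i.e. the coefficient of `z` in `𝓛_μ[z]` apart from `(α² + β²)²`. -/
def gardnerPotential (α β μ t x₁ x₂ x : ℝ) : ℝ :=
  let B := gardnerBreather α β μ t x₁ x₂
  5 * deriv B x ^ 2 + 10 * B x * iteratedDeriv 2 B x + 15 / 2 * B x ^ 4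
    - 6 * (β ^ 2 - α ^ 2) * B x ^ 2
    + 3 * μ * (10 * B x ^ 3 - 4 * (β ^ 2 - α ^ 2) * B x + 10 / 3 * iteratedDeriv 2 B x
      + 10 * μ * B x ^ 2)

/-- The linearized operator `𝓛_μ` around the Gardner breather. -/
def gardnerL (α β μ t x₁ x₂ : ℝ) (z : ℝ → ℝ) (x : ℝ) : ℝ :=
  let B := gardnerBreather α β μ t x₁ x₂
  iteratedDeriv 4 z x - 2 * (β ^ 2 - α ^ 2) * iteratedDeriv 2 z x + (α ^ 2 + β ^ 2) ^ 2 * z x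
    + 5 * B x ^ 2 * iteratedDeriv 2 z x + 10 * B x * deriv B x * deriv z x
    + 10 * μ * B x * iteratedDeriv 2 z x + 10 * μ * deriv B x * deriv z x
    + gardnerPotential α β μ t x₁ x₂ x * z x

/-- `g` is a weak derivative of `f` on the real line (both locally integrable). -/
def HasWeakDeriv (f g : ℝ → ℝ) : Prop :=
  LocallyIntegrable f ∧ LocallyIntegrable g ∧
    ∀ φ : ℝ → ℝ, ContDiff ℝ ∞ φ → HasCompactSupport φ →
      ∫ x, f x * deriv φ x = -∫ x, g x * φ x

/-- A representative of the weak derivative of `f` (unique up to null sets) if there is one. -/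
def weakDeriv (f : ℝ → ℝ) : ℝ → ℝ :=
  open Classical in if h : ∃ g, HasWeakDeriv f g then h.choose else 0

/-- `z` belongs to the Sobolev space `H²(ℝ)`. -/
def MemH2 (z : ℝ → ℝ) : Prop :=
  MemLp z 2 ∧ ∃ z₁, MemLp z₁ 2 ∧ HasWeakDeriv z z₁ ∧ ∃ z₂, MemLp z₂ 2 ∧ HasWeakDeriv z₁ z₂

/-- The quadratic form `𝓠_μ` of `𝓛_μ` on `H²(ℝ)`, i.e. `∫ z 𝓛_μ[z]` after integration by parts,
with weak derivatives `z_x` and `z_xx`. -/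
def gardnerQ (α β μ t x₁ x₂ : ℝ) (z : ℝ → ℝ) : ℝ :=
  let B := gardnerBreather α β μ t x₁ x₂
  ∫ x, (weakDeriv (weakDeriv z) x ^ 2
    + (2 * (β ^ 2 - α ^ 2) - 5 * B x ^ 2 - 10 * μ * B x) * weakDeriv z x ^ 2
    + ((α ^ 2 + β ^ 2) ^ 2 + gardnerPotential α β μ t x₁ x₂ x) * z x ^ 2)

/-- A positive direction for `𝓠_μ`: a nonzero element `z` of `H²(ℝ)` with `𝓠_μ[z] > 0`. -/
def IsPositiveDirection (α β μ t x₁ x₂ : ℝ) (z : ℝ → ℝ) : Prop :=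
  MemH2 z ∧ ¬ z =ᵐ[volume] 0 ∧ 0 < gardnerQ α β μ t x₁ x₂ z

/-- A negative direction for `𝓠_μ`: a nonzero element `z` of `H²(ℝ)` with `𝓠_μ[z] < 0`. -/
def IsNegativeDirection (α β μ t x₁ x₂ : ℝ) (z : ℝ → ℝ) : Prop :=
  MemH2 z ∧ ¬ z =ᵐ[volume] 0 ∧ gardnerQ α β μ t x₁ x₂ z < 0

end

/-! The function `H = F + iG` is a sum of four exponentials, with exponents `±β` and `±iα`, and `B =
2√2 Im (H_x / H)`. Three bilinear identities between `H` and its conjugate (`tau_bilinear`) show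
that `p = Im (H_x / H)`, `q = Re (H_x / H)` and `w = Im (H_xx / H)` solve a closed polynomial system
whose parameters are `κ = √2 μ` and `δ = β² - α²`, on the level `c = α²β²` of a first integral.
Since the identities hold for all nearby parameters, differentiation along a curve of parameters `θ`
gives a solution `(dp, dq, dw)` of the linearized system, and `∂_θ B = 2√2 dp`.

Four differentiations of `dp`, reduced by the first integral and its linearization, show that `𝓛_μ`
sends `∂_θ B` to an explicit expression in `p, q, w` (`BreatherFlow.hasDerivAt_D₃`,
`gardnerL_eq_flowRhs`): what is left is the explicit dependence on `δ` and on `δ² + 4c = (α² + β²)²`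
of the fourth order equation for `p`. Its product with `∂_θ B` has an explicit primitive in the flow
variables and `S = Im (∂_θ H / H)`, which satisfies `S_x = dp`
(`BreatherFlow.hasDerivAt_primitive`).

The integral is thus a difference of boundary values. At each end one real exponential dominates `H`
(`expTendsto_of_dominant_mode`): exponentially fast, `q → ±β` and `dq → ±∂_θ β`, while `p, w, dp, dw
→ 0`. The limit of `S` is the `θ`-derivative of the argument of the dominant coefficient; it
vanishes at `-∞`, where the coefficient is `1/2`, and produces the denominator `Δ² + 8μ²β²` at `+∞`.
The same decay gives membership in `H²` and removes the boundary terms between `𝓠_μ` and `∫ z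
𝓛_μ[z]`. `gardner_scaling` does this for any curve of parameters; the coordinate curves give the two
values. -/

noncomputable section

/-! ### Exponential convergence at infinity. -/

open Filter Asymptotics Topology

/-- `f` converges to `c` along `l` at the exponential rate `r`. -/
def ExpTendsto {E : Type*} [NormedAddCommGroup E] (l : Filter ℝ) (r : ℝ) (f : ℝ → E) (c : E) :
    Prop :=
  (fun x => f x - c) =O[l] fun x => Real.exp (-r * |x|)

namespace ExpTendsto

variable {E A : Type*} [NormedAddCommGroup E] [NormedRing A] {l : Filter ℝ} {r : ℝ}

theorem const (c : E) : ExpTendsto l r (fun _ => c) c := by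
  simp [ExpTendsto, isBigO_zero]

theorem congr {f g : ℝ → E} {c d : E} (hf : ExpTendsto l r f c) (h : ∀ x, f x = g x)
    (hc : c = d) : ExpTendsto l r g d := by
  rwa [← funext h, ← hc]

theorem add {f g : ℝ → E} {c d : E} (hf : ExpTendsto l r f c) (hg : ExpTendsto l r g d) :
    ExpTendsto l r (fun x => f x + g x) (c + d) := by
  refine (IsBigO.add hf hg).congr_left fun x => ?_
  exact (add_sub_add_comm _ _ _ _).symm

theorem sub {f g : ℝ → E} {c d : E} (hf : ExpTendsto l r f c) (hg : ExpTendsto l r g d) :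
    ExpTendsto l r (fun x => f x - g x) (c - d) := by
  refine (IsBigO.sub hf hg).congr_left fun x => ?_
  exact (sub_sub_sub_comm _ _ _ _)

theorem isBigO_one (hr : 0 ≤ r) {f : ℝ → E} {c : E} (hf : ExpTendsto l r f c) :
    f =O[l] fun _ => (1 : ℝ) := by
  have h : (fun x : ℝ => Real.exp (-r * |x|)) =O[l] fun _ => (1 : ℝ) := by
    refine IsBigO.of_bound 1 (Eventually.of_forall fun x => ?_)
    have h0 : 0 ≤ r * |x| := by positivity
    simpa using h0
  have h2 := (IsBigO.trans hf h).add (isBigO_const_const c (one_ne_zero (α := ℝ)) l)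
  exact h2.congr_left fun x => by abel

theorem mul (hr : 0 ≤ r) {f g : ℝ → A} {c d : A} (hf : ExpTendsto l r f c)
    (hg : ExpTendsto l r g d) : ExpTendsto l r (fun x => f x * g x) (c * d) := by
  have h1 := IsBigO.mul hf (hg.isBigO_one hr)
  have h2 := (isBigO_const_const c (one_ne_zero (α := ℝ)) l).mul hg
  simp only [mul_one, one_mul] at h1 h2
  refine (h1.add h2).congr_left fun x => ?_
  noncomm_ring

theorem re {f : ℝ → ℂ} {c : ℂ} (hf : ExpTendsto l r f c) :
    ExpTendsto l r (fun x => (f x).re) c.re := by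
  refine IsBigO.trans (IsBigO.of_bound 1 (Eventually.of_forall fun x => ?_)) hf
  simpa using Complex.abs_re_le_norm (f x - c)

theorem im {f : ℝ → ℂ} {c : ℂ} (hf : ExpTendsto l r f c) :
    ExpTendsto l r (fun x => (f x).im) c.im := by
  refine IsBigO.trans (IsBigO.of_bound 1 (Eventually.of_forall fun x => ?_)) hf
  simpa using Complex.abs_im_le_norm (f x - c)

theorem tendsto (hl : Tendsto (fun x : ℝ => |x|) l atTop) (hr : 0 < r) {f : ℝ → E} {c : E}
    (hf : ExpTendsto l r f c) : Tendsto f l (𝓝 c) := by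
  have h : Tendsto (fun x : ℝ => Real.exp (-r * |x|)) l (𝓝 0) :=
    Real.tendsto_exp_atBot.comp (hl.const_mul_atTop_of_neg (by linarith : -r < 0))
  have h2 := (IsBigO.trans_tendsto hf h).add_const c
  simpa using h2

end ExpTendsto

theorem integrable_of_expTendsto_zero {r : ℝ} (hr : 0 < r) {f : ℝ → ℝ} (hc : Continuous f)
    (h1 : ExpTendsto atTop r f 0) (h2 : ExpTendsto atBot r f 0) : Integrable f := by
  have e1 : f =O[atTop] fun x => Real.exp (-r * x) := by
    have h := h1
    simp only [ExpTendsto, sub_zero] at h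
    refine h.trans (EventuallyEq.isBigO ?_)
    filter_upwards [eventually_ge_atTop 0] with x hx
    rw [abs_of_nonneg hx]
  have e2 : (fun x => f (-x)) =O[atTop] fun x => Real.exp (-r * x) := by
    have h := h2
    simp only [ExpTendsto, sub_zero] at h
    refine (h.comp_tendsto tendsto_neg_atTop_atBot).trans (EventuallyEq.isBigO ?_)
    filter_upwards [eventually_ge_atTop 0] with x hx
    simp [abs_of_nonneg hx]
  have i1 := integrable_of_isBigO_exp_neg (a := 0) hr hc.continuousOn e1
  have i2 := integrable_of_isBigO_exp_neg (a := 0) hr (hc.comp continuous_neg).continuousOn e2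
  have i3 : IntegrableOn f (Set.Iic 0) := by
    rw [integrableOn_Iic_iff_integrableOn_Iio]
    have h := (MeasurePreserving.integrableOn_comp_preimage
      (Measure.measurePreserving_neg (volume : Measure ℝ))
      (Homeomorph.neg ℝ).measurableEmbedding (f := f) (s := Set.Iio 0)).1
    apply h
    convert i2 using 1
    ext x; simp
  rw [← integrableOn_univ, ← Set.Iic_union_Ioi (a := (0 : ℝ))]
  exact i3.union i1

/-! ### Weak derivatives of smooth functions. -/

theorem hasWeakDeriv_of_hasDerivAt {f g : ℝ → ℝ} (h : ∀ x, HasDerivAt f (g x) x)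
    (hg : Continuous g) : HasWeakDeriv f g := by
  have hf : Continuous f := continuous_iff_continuousAt.2 fun x => (h x).continuousAt
  refine ⟨hf.locallyIntegrable, hg.locallyIntegrable, fun φ hφ hs => ?_⟩
  have hφ' : Continuous (deriv φ) := hφ.continuous_deriv (by simp)
  refine integral_mul_deriv_eq_deriv_mul_of_integrable (u := f) (v := φ) (fun x _ => h x)
    (fun x _ => (hφ.differentiable (by simp) x).hasDerivAt) ?_ ?_ ?_
  · exact (hf.mul hφ').integrable_of_hasCompactSupport hs.deriv.mul_left
  · exact (hg.mul hφ.continuous).integrable_of_hasCompactSupport hs.mul_left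
  · exact (hf.mul hφ.continuous).integrable_of_hasCompactSupport hs.mul_left

theorem HasWeakDeriv.ae_unique {f g h : ℝ → ℝ} (hg : HasWeakDeriv f g) (hh : HasWeakDeriv f h) :
    g =ᵐ[volume] h := by
  refine ae_eq_of_integral_contDiff_smul_eq hg.2.1 hh.2.1 fun φ hφ hs => ?_
  have h1 := hg.2.2 φ hφ hs
  have h2 := hh.2.2 φ hφ hs
  simp only [smul_eq_mul, mul_comm (φ _)]
  linarith

/-- `weakDeriv` is a chosen representative, known only up to null sets; its own weak derivative is
reached through this congruence. -/
theorem HasWeakDeriv.congr_ae {f f' g : ℝ → ℝ} (hg : HasWeakDeriv f g)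
    (hf' : f =ᵐ[volume] f') : HasWeakDeriv f' g := by
  refine ⟨hg.1.congr hf', hg.2.1, fun φ hφ hs => ?_⟩
  rw [← hg.2.2 φ hφ hs]
  refine integral_congr_ae ?_
  filter_upwards [hf'] with x hx
  rw [hx]

theorem HasWeakDeriv.weakDeriv_ae_eq {f g : ℝ → ℝ} (hg : HasWeakDeriv f g) :
    weakDeriv f =ᵐ[volume] g := by
  have hex : ∃ g, HasWeakDeriv f g := ⟨g, hg⟩
  rw [weakDeriv, dif_pos hex]
  exact hex.choose_spec.ae_unique hg

theorem memLp_two_of_expTendsto_zero {r : ℝ} (hr : 0 < r) {f : ℝ → ℝ} (hc : Continuous f)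
    (h1 : ExpTendsto atTop r f 0) (h2 : ExpTendsto atBot r f 0) : MemLp f 2 := by
  rw [memLp_two_iff_integrable_sq hc.aestronglyMeasurable]
  refine integrable_of_expTendsto_zero hr (hc.pow 2) ?_ ?_
  · simpa [pow_two] using h1.mul hr.le h1
  · simpa [pow_two] using h2.mul hr.le h2

/-! ### The flow of the logarithmic derivatives and its linearization. -/

/-- A trajectory `(p, q, w)` of the autonomous system solved by `p = Im (H'/H)`, `q = Re (H'/H)`,
`w = Im (H''/H)` for the tau function `H` of a Gardner breather, on the level set of its first
integral, together with a solution `(dp, dq, dw)` of the linearized system in which the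
parameters `δ` and `c` vary with speed `dδ` and `dc`. -/
structure BreatherFlow (κ δ c dδ dc : ℝ) (p q w dp dq dw : ℝ → ℝ) : Prop where
  hasDerivAt_p : ∀ x, HasDerivAt p (w x - 2 * p x * q x) x
  hasDerivAt_q : ∀ x, HasDerivAt q (2 * p x ^ 2 + κ * p x) x
  hasDerivAt_w : ∀ x, HasDerivAt w
    (δ * p x - 2 * p x * (p x ^ 2 + q x ^ 2 + κ * p x)) x
  hasDerivAt_dp : ∀ x, HasDerivAt dp (dw x - 2 * (dp x * q x + p x * dq x)) x
  hasDerivAt_dq : ∀ x, HasDerivAt dq ((4 * p x + κ) * dp x) x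
  hasDerivAt_dw : ∀ x, HasDerivAt dw
    (dδ * p x + δ * dp x - 2 * dp x * (p x ^ 2 + q x ^ 2 + κ * p x)
      - 2 * p x * (2 * p x * dp x + 2 * q x * dq x + κ * dp x)) x
  first_integral : ∀ x, (p x ^ 2 + q x ^ 2 + κ * p x) ^ 2 + w x ^ 2 - c
    - δ * (p x ^ 2 + q x ^ 2) + 2 * κ * (w x * q x - (p x ^ 2 + q x ^ 2 + κ * p x) * p x) = 0
  first_integral_lin : ∀ x,
    2 * (p x ^ 2 + q x ^ 2 + κ * p x) * (2 * p x * dp x + 2 * q x * dq x + κ * dp x)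
    + 2 * w x * dw x - dc - dδ * (p x ^ 2 + q x ^ 2) - δ * (2 * p x * dp x + 2 * q x * dq x)
    + 2 * κ * (dw x * q x + w x * dq x
      - (2 * p x * dp x + 2 * q x * dq x + κ * dp x) * p x
      - (p x ^ 2 + q x ^ 2 + κ * p x) * dp x) = 0

/-- Exponentially fast convergence of `(p, q, w, dp, dq, dw)` to `(0, b, 0, 0, db, 0)`. -/
structure BreatherAsymptotics (l : Filter ℝ) (r b db : ℝ) (p q w dp dq dw : ℝ → ℝ) : Prop where
  p : ExpTendsto l r p 0
  q : ExpTendsto l r q b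
  w : ExpTendsto l r w 0
  dp : ExpTendsto l r dp 0
  dq : ExpTendsto l r dq db
  dw : ExpTendsto l r dw 0

/-- `∂ₓ² p` along the flow. -/
def flowP₂ (κ δ p q w : ℝ) : ℝ :=
  δ * p + 2 * p * q ^ 2 - 2 * q * w - 4 * κ * p ^ 2 - 6 * p ^ 3

/-- `∂ₓ dp` along the linearized flow. -/
def flowD₁ (p q dp dq dw : ℝ) : ℝ := dw - 2 * (dp * q + p * dq)

/-- `∂ₓ² dp` along the linearized flow. -/
def flowD₂ (κ δ dδ p q w dp dq dw : ℝ) : ℝ :=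
  dδ * p + (δ + 2 * q ^ 2 - 8 * κ * p - 18 * p ^ 2) * dp + (4 * p * q - 2 * w) * dq - 2 * q * dw

/-- `∂ₓ³ dp` along the linearized flow. -/
def flowD₃ (κ δ dδ p q w dp dq dw : ℝ) : ℝ :=
  dδ * (w - 4 * p * q)
    + (-10 * κ * w - 4 * δ * q - 44 * p * w + 48 * κ * p * q + 144 * p ^ 2 * q) * dp
    + (4 * q * w - 4 * δ * p + 24 * κ * p ^ 2 + 48 * p ^ 3) * dq
    + (δ + 2 * q ^ 2 - 10 * κ * p - 22 * p ^ 2) * dw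

/-- The potential of the linearized operator in terms of the flow variables. -/
def flowV (κ δ p q w : ℝ) : ℝ :=
  40 * (w - 2 * p * q) ^ 2 + 80 * p * flowP₂ κ δ p q w + 480 * p ^ 4 - 48 * δ * p ^ 2
    + 480 * κ * p ^ 3 - 24 * κ * δ * p + 20 * κ * flowP₂ κ δ p q w + 120 * κ ^ 2 * p ^ 2

/-- The value of the linearized operator at `dp`, up to a constant factor. -/
def flowRhs (κ δ dδ dc p q w : ℝ) : ℝ :=
  2 * dδ * (flowP₂ κ δ p q w + 6 * κ * p ^ 2 + 8 * p ^ 3) - (2 * δ * dδ + 4 * dc) * p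

/-- `∂ₓ⁴ dp` along the linearized flow. -/
def flowD₄ (κ δ c dδ dc p q w dp dq dw : ℝ) : ℝ :=
  flowRhs κ δ dδ dc p q w + 2 * δ * flowD₂ κ δ dδ p q w dp dq dw - (δ ^ 2 + 4 * c) * dp
    - 40 * p ^ 2 * flowD₂ κ δ dδ p q w dp dq dw
    - 80 * p * (w - 2 * p * q) * flowD₁ p q dp dq dw
    - 20 * κ * p * flowD₂ κ δ dδ p q w dp dq dw
    - 20 * κ * (w - 2 * p * q) * flowD₁ p q dp dq dw - flowV κ δ p q w * dp

namespace BreatherFlow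

variable {κ δ c dδ dc : ℝ} {p q w dp dq dw : ℝ → ℝ}

theorem hasDerivAt_p₁ (h : BreatherFlow κ δ c dδ dc p q w dp dq dw) (x : ℝ) :
    HasDerivAt (fun x => w x - 2 * p x * q x) (flowP₂ κ δ (p x) (q x) (w x)) x := by
  have hp := h.hasDerivAt_p x
  have hq := h.hasDerivAt_q x
  have hw := h.hasDerivAt_w x
  refine (hw.sub ((hp.const_mul 2).mul hq)).congr_deriv ?_
  unfold flowP₂; ring

theorem hasDerivAt_D₁ (h : BreatherFlow κ δ c dδ dc p q w dp dq dw) (x : ℝ) :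
    HasDerivAt (fun x => flowD₁ (p x) (q x) (dp x) (dq x) (dw x))
      (flowD₂ κ δ dδ (p x) (q x) (w x) (dp x) (dq x) (dw x)) x := by
  have hp := h.hasDerivAt_p x
  have hq := h.hasDerivAt_q x
  have hdp := h.hasDerivAt_dp x
  have hdq := h.hasDerivAt_dq x
  have hdw := h.hasDerivAt_dw x
  refine (hdw.sub (((hdp.mul hq).add (hp.mul hdq)).const_mul 2)).congr_deriv ?_
  unfold flowD₂; ring

theorem hasDerivAt_D₂ (h : BreatherFlow κ δ c dδ dc p q w dp dq dw) (x : ℝ) :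
    HasDerivAt (fun x => flowD₂ κ δ dδ (p x) (q x) (w x) (dp x) (dq x) (dw x))
      (flowD₃ κ δ dδ (p x) (q x) (w x) (dp x) (dq x) (dw x)) x := by
  have hp := h.hasDerivAt_p x
  have hq := h.hasDerivAt_q x
  have hw := h.hasDerivAt_w x
  have hdp := h.hasDerivAt_dp x
  have hdq := h.hasDerivAt_dq x
  have hdw := h.hasDerivAt_dw x
  unfold flowD₂
  refine ((((hp.const_mul dδ).add (((((hq.pow 2).const_mul 2).const_add δ).sub
    (hp.const_mul (8 * κ))).sub ((hp.pow 2).const_mul 18) |>.mul hdp)).add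
    ((((hp.const_mul 4).mul hq).sub (hw.const_mul 2)).mul hdq)).sub
    ((hq.const_mul 2).mul hdw)).congr_deriv ?_
  simp only [Pi.sub_apply, Pi.mul_apply, Pi.pow_apply]
  unfold flowD₃; push_cast; ring

theorem hasDerivAt_D₃ (h : BreatherFlow κ δ c dδ dc p q w dp dq dw) (x : ℝ) :
    HasDerivAt (fun x => flowD₃ κ δ dδ (p x) (q x) (w x) (dp x) (dq x) (dw x))
      (flowD₄ κ δ c dδ dc (p x) (q x) (w x) (dp x) (dq x) (dw x)) x := by
  have hp := h.hasDerivAt_p x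
  have hq := h.hasDerivAt_q x
  have hw := h.hasDerivAt_w x
  have hdp := h.hasDerivAt_dp x
  have hdq := h.hasDerivAt_dq x
  have hdw := h.hasDerivAt_dw x
  unfold flowD₃
  refine ((((hw.sub ((hp.const_mul 4).mul hq)).const_mul dδ).add
    ((((((hw.const_mul (-10 * κ)).sub (hq.const_mul (4 * δ))).sub
      ((hp.const_mul 44).mul hw)).add ((hp.const_mul (48 * κ)).mul hq)).add
      (((hp.pow 2).const_mul 144).mul hq)).mul hdp)).add
    ((((((hq.const_mul 4).mul hw).sub (hp.const_mul (4 * δ))).add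
      ((hp.pow 2).const_mul (24 * κ))).add ((hp.pow 3).const_mul 48)).mul hdq)).add
    ((((((hq.pow 2).const_mul 2).const_add δ).sub (hp.const_mul (10 * κ))).sub
      ((hp.pow 2).const_mul 22)).mul hdw) |>.congr_deriv ?_
  simp only [Pi.sub_apply, Pi.mul_apply, Pi.pow_apply, Pi.add_apply]
  unfold flowD₄ flowRhs flowV flowP₂ flowD₂ flowD₁
  push_cast
  -- The fourth derivative has the form `flowD₄` only on the level set: the discrepancy is `-4`
  -- times the linearization of `p` times the first integral.
  linear_combination (-4 * dp x) * h.first_integral x - 4 * p x * h.first_integral_lin x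

theorem continuous_all (h : BreatherFlow κ δ c dδ dc p q w dp dq dw) :
    Continuous p ∧ Continuous q ∧ Continuous w ∧ Continuous dp ∧ Continuous dq ∧
      Continuous dw :=
  ⟨continuous_iff_continuousAt.2 fun x => (h.hasDerivAt_p x).continuousAt,
    continuous_iff_continuousAt.2 fun x => (h.hasDerivAt_q x).continuousAt,
    continuous_iff_continuousAt.2 fun x => (h.hasDerivAt_w x).continuousAt,
    continuous_iff_continuousAt.2 fun x => (h.hasDerivAt_dp x).continuousAt,
    continuous_iff_continuousAt.2 fun x => (h.hasDerivAt_dq x).continuousAt,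
    continuous_iff_continuousAt.2 fun x => (h.hasDerivAt_dw x).continuousAt⟩

/-- Bootstrap: the right sides are polynomials in the six unknowns, so each order of smoothness
yields the next. -/
theorem contDiff_all (h : BreatherFlow κ δ c dδ dc p q w dp dq dw) (n : ℕ) :
    ContDiff ℝ n p ∧ ContDiff ℝ n q ∧ ContDiff ℝ n w ∧ ContDiff ℝ n dp ∧ ContDiff ℝ n dq ∧
      ContDiff ℝ n dw := by
  have key : ∀ (n : ℕ) (f g : ℝ → ℝ), (∀ x, HasDerivAt f (g x) x) → ContDiff ℝ n g →
      ContDiff ℝ ((n + 1 : ℕ) : WithTop ℕ∞) f := by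
    intro n f g hfg hg
    have hd : deriv f = g := funext fun x => (hfg x).deriv
    push_cast
    refine contDiff_succ_iff_deriv.2 ⟨fun x => (hfg x).differentiableAt, by simp, ?_⟩
    rwa [hd]
  induction n with
  | zero => simpa [contDiff_zero] using h.continuous_all
  | succ n ih =>
    obtain ⟨ip, iq, iw, idp, idq, idw⟩ := ih
    exact ⟨key n _ _ h.hasDerivAt_p (by fun_prop), key n _ _ h.hasDerivAt_q (by fun_prop),
      key n _ _ h.hasDerivAt_w (by fun_prop), key n _ _ h.hasDerivAt_dp (by fun_prop),
      key n _ _ h.hasDerivAt_dq (by fun_prop), key n _ _ h.hasDerivAt_dw (by fun_prop)⟩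

theorem contDiff_dp (h : BreatherFlow κ δ c dδ dc p q w dp dq dw) : ContDiff ℝ ∞ dp :=
  contDiff_infty.2 fun n => (h.contDiff_all n).2.2.2.1

end BreatherFlow

namespace BreatherAsymptotics

variable {l : Filter ℝ} {r b db : ℝ} {p q w dp dq dw : ℝ → ℝ}

theorem p₁ (h : BreatherAsymptotics l r b db p q w dp dq dw) (hr : 0 ≤ r) :
    ExpTendsto l r (fun x => w x - 2 * p x * q x) 0 := by
  simpa using h.w.sub (((ExpTendsto.const 2).mul hr h.p).mul hr h.q)

theorem p₂ (h : BreatherAsymptotics l r b db p q w dp dq dw) (hr : 0 ≤ r) (κ δ : ℝ) :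
    ExpTendsto l r (fun x => flowP₂ κ δ (p x) (q x) (w x)) 0 := by
  unfold flowP₂
  have hpq := ((ExpTendsto.const 2).mul hr h.p).mul hr (h.q.mul hr h.q)
  have hqw := ((ExpTendsto.const 2).mul hr h.q).mul hr h.w
  have hpp := h.p.mul hr h.p
  have := ((((((ExpTendsto.const δ).mul hr h.p).add hpq).sub hqw).sub
    ((ExpTendsto.const (4 * κ)).mul hr hpp)).sub
    ((ExpTendsto.const 6).mul hr (hpp.mul hr h.p)))
  simp only [mul_zero, zero_mul, add_zero, sub_zero] at this
  exact this.congr (fun x => by ring) rfl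

theorem D₁ (h : BreatherAsymptotics l r b db p q w dp dq dw) (hr : 0 ≤ r) :
    ExpTendsto l r (fun x => flowD₁ (p x) (q x) (dp x) (dq x) (dw x)) 0 := by
  exact (h.dw.sub ((ExpTendsto.const 2).mul hr ((h.dp.mul hr h.q).add (h.p.mul hr h.dq)))).congr
    (fun x => rfl) (by simp)

theorem D₂ (h : BreatherAsymptotics l r b db p q w dp dq dw) (hr : 0 ≤ r) (κ δ dδ : ℝ) :
    ExpTendsto l r (fun x => flowD₂ κ δ dδ (p x) (q x) (w x) (dp x) (dq x) (dw x)) 0 := by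
  have c (a : ℝ) : ExpTendsto l r (fun _ => a) a := ExpTendsto.const a
  have := ((((c dδ).mul hr h.p).add ((((((c δ).add ((c 2).mul hr (h.q.mul hr h.q))).sub
    ((c (8 * κ)).mul hr h.p))).sub ((c 18).mul hr (h.p.mul hr h.p))).mul hr h.dp)).add
    ((((c 4).mul hr (h.p.mul hr h.q)).sub ((c 2).mul hr h.w)).mul hr h.dq)).sub
    (((c 2).mul hr h.q).mul hr h.dw)
  simp only [mul_zero, zero_mul, add_zero, sub_zero] at this
  exact this.congr (fun x => by unfold flowD₂; ring) rfl

theorem D₃ (h : BreatherAsymptotics l r b db p q w dp dq dw) (hr : 0 ≤ r) (κ δ dδ : ℝ) :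
    ExpTendsto l r (fun x => flowD₃ κ δ dδ (p x) (q x) (w x) (dp x) (dq x) (dw x)) 0 := by
  have c (a : ℝ) : ExpTendsto l r (fun _ => a) a := ExpTendsto.const a
  have hpq := h.p.mul hr h.q
  have hpp := h.p.mul hr h.p
  have e1 := (c dδ).mul hr (h.w.sub ((c 4).mul hr hpq))
  have e2 := ((((((c (-10 * κ)).mul hr h.w).sub ((c (4 * δ)).mul hr h.q)).sub
    ((c 44).mul hr (h.p.mul hr h.w))).add ((c (48 * κ)).mul hr hpq)).add
    ((c 144).mul hr (h.p.mul hr hpq))).mul hr h.dp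
  have e3 := (((((c 4).mul hr (h.q.mul hr h.w)).sub ((c (4 * δ)).mul hr h.p)).add
    ((c (24 * κ)).mul hr hpp)).add ((c 48).mul hr (h.p.mul hr hpp))).mul hr h.dq
  have e4 := ((((c δ).add ((c 2).mul hr (h.q.mul hr h.q))).sub ((c (10 * κ)).mul hr h.p)).sub
    ((c 22).mul hr hpp)).mul hr h.dw
  have := ((e1.add e2).add e3).add e4
  simp only [mul_zero, zero_mul, add_zero, sub_zero] at this
  exact this.congr (fun x => by unfold flowD₃; ring) rfl

theorem flowV (h : BreatherAsymptotics l r b db p q w dp dq dw) (hr : 0 ≤ r) (κ δ : ℝ) :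
    ExpTendsto l r (fun x => flowV κ δ (p x) (q x) (w x)) 0 := by
  have c (a : ℝ) : ExpTendsto l r (fun _ => a) a := ExpTendsto.const a
  have h1 := h.p₁ hr
  have h2 := h.p₂ hr κ δ
  have hpp := h.p.mul hr h.p
  have := ((((((((c 40).mul hr (h1.mul hr h1)).add ((c 80).mul hr (h.p.mul hr h2))).add
    ((c 480).mul hr (hpp.mul hr hpp))).sub ((c (48 * δ)).mul hr hpp)).add
    ((c (480 * κ)).mul hr (h.p.mul hr hpp))).sub ((c (24 * κ * δ)).mul hr h.p)).add
    ((c (20 * κ)).mul hr h2)).add ((c (120 * κ ^ 2)).mul hr hpp)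
  simp only [mul_zero, add_zero, sub_zero] at this
  exact this.congr (fun x => by unfold _root_.flowV; ring) rfl

theorem flowRhs (h : BreatherAsymptotics l r b db p q w dp dq dw) (hr : 0 ≤ r)
    (κ δ dδ dc : ℝ) : ExpTendsto l r (fun x => flowRhs κ δ dδ dc (p x) (q x) (w x)) 0 := by
  have c (a : ℝ) : ExpTendsto l r (fun _ => a) a := ExpTendsto.const a
  have hpp := h.p.mul hr h.p
  have := ((c (2 * dδ)).mul hr (((h.p₂ hr κ δ).add ((c (6 * κ)).mul hr hpp)).add
    ((c 8).mul hr (h.p.mul hr hpp)))).sub ((c (2 * δ * dδ + 4 * dc)).mul hr h.p)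
  simp only [mul_zero, add_zero, sub_zero] at this
  exact this.congr (fun x => by unfold _root_.flowRhs; ring) rfl

end BreatherAsymptotics

/-! ### An explicit primitive and its boundary values. -/

/-- The `θ`-derivative of the potential of the energy density, up to an integral of `dp`. -/
def flowEnergy (κ δ dδ p q w dp dq dw : ℝ) : ℝ :=
  (1 / 3) * (8 * (dp * (w - 2 * p * q) + p * flowD₁ p q dp dq dw)
      + 2 * κ * flowD₁ p q dp dq dw
      + 4 * (dq * (p ^ 2 + q ^ 2 + κ * p) + q * (2 * p * dp + 2 * q * dq + κ * dp)
        + dp * w + p * dw + κ * dw) - 6 * dδ * q - 6 * δ * dq) + 2 * κ ^ 2 * dq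

/-- A primitive of `8 * dp * flowRhs`, where `S` is a primitive of `dp`. -/
def flowPrimitive (κ δ dδ dc p q w dp dq dw S : ℝ) : ℝ :=
  16 * dδ * ((w - 2 * p * q) * dp - flowEnergy κ δ dδ p q w dp dq dw / 8 + κ ^ 3 / 4 * S)
    - 2 * (2 * δ * dδ + 4 * dc) * (dq - κ * S)

/-- The term `p * dp` integrates because `dq_x = (4p + κ) dp`, so `4 p dp` is the derivative of `dq
- κ S`. The term `dp * (p_xx + 6κp² + 8p³)` is the derivative of `p_x dp` minus the variation of the
density `p_x²/2 - 2κp³ - 2p⁴`, whose primitive is `flowEnergy / 8 - κ³ S / 4`. -/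
theorem BreatherFlow.hasDerivAt_primitive {κ δ c dδ dc : ℝ} {p q w dp dq dw S : ℝ → ℝ}
    (h : BreatherFlow κ δ c dδ dc p q w dp dq dw) (hS : ∀ x, HasDerivAt S (dp x) x) (x : ℝ) :
    HasDerivAt (fun x => flowPrimitive κ δ dδ dc (p x) (q x) (w x) (dp x) (dq x) (dw x) (S x))
      (8 * (dp x * flowRhs κ δ dδ dc (p x) (q x) (w x))) x := by
  have hp := h.hasDerivAt_p x
  have hq := h.hasDerivAt_q x
  have hw := h.hasDerivAt_w x
  have hp1 := h.hasDerivAt_p₁ x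
  have hdp := h.hasDerivAt_dp x
  have hdq := h.hasDerivAt_dq x
  have hdw := h.hasDerivAt_dw x
  have hd1 := h.hasDerivAt_D₁ x
  have hq2 := ((hp.pow 2).add (hq.pow 2)).add (hp.const_mul κ)
  have hdq2 := ((((hp.const_mul 2).mul hdp).add ((hq.const_mul 2).mul hdq)).add
    (hdp.const_mul κ))
  have hE := (((((((hdp.mul hp1).add (hp.mul hd1)).const_mul 8).add (hd1.const_mul (2 * κ))).add
    (((((hdq.mul hq2).add (hq.mul hdq2)).add (hdp.mul hw)).add (hp.mul hdw) |>.add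
      (hdw.const_mul κ)).const_mul 4)).sub (hq.const_mul (6 * dδ))).sub
      (hdq.const_mul (6 * δ))).const_mul (1 / 3) |>.add (hdq.const_mul (2 * κ ^ 2))
  have := ((((hp1.mul hdp).sub (hE.div_const 8)).add ((hS x).const_mul (κ ^ 3 / 4))).const_mul
    (16 * dδ)).sub ((hdq.sub ((hS x).const_mul κ)).const_mul (2 * (2 * δ * dδ + 4 * dc)))
  unfold flowPrimitive flowEnergy
  refine this.congr_deriv ?_
  simp only [Pi.mul_apply, Pi.pow_apply, Pi.add_apply]
  unfold flowRhs flowP₂ flowD₂ flowD₁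
  push_cast
  ring

theorem BreatherAsymptotics.tendsto_primitive {κ δ dδ dc : ℝ} {p q w dp dq dw S : ℝ → ℝ}
    {l : Filter ℝ} {r b db s : ℝ} (h : BreatherAsymptotics l r b db p q w dp dq dw)
    (hl : Tendsto (fun x : ℝ => |x|) l atTop) (hr : 0 < r) (hS : Tendsto S l (𝓝 s)) :
    Tendsto (fun x => flowPrimitive κ δ dδ dc (p x) (q x) (w x) (dp x) (dq x) (dw x) (S x)) l
      (𝓝 (flowPrimitive κ δ dδ dc 0 b 0 0 db 0 s)) := by
  have hp := h.p.tendsto hl hr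
  have hq := h.q.tendsto hl hr
  have hw := h.w.tendsto hl hr
  have hdp := h.dp.tendsto hl hr
  have hdq := h.dq.tendsto hl hr
  have hdw := h.dw.tendsto hl hr
  have h1 : Tendsto (fun x => flowD₁ (p x) (q x) (dp x) (dq x) (dw x)) l
      (𝓝 (flowD₁ 0 b 0 db 0)) := by
    unfold flowD₁
    exact hdw.sub (((hdp.mul hq).add (hp.mul hdq)).const_mul 2)
  have hE : Tendsto (fun x => flowEnergy κ δ dδ (p x) (q x) (w x) (dp x) (dq x) (dw x)) l
      (𝓝 (flowEnergy κ δ dδ 0 b 0 0 db 0)) := by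
    have e1 := (((hdp.mul (hw.sub ((hp.const_mul 2).mul hq))).add (hp.mul h1)).const_mul 8).add
      (h1.const_mul (2 * κ))
    have e2 := ((((hdq.mul (((hp.pow 2).add (hq.pow 2)).add (hp.const_mul κ))).add
      (hq.mul ((((hp.const_mul 2).mul hdp).add ((hq.const_mul 2).mul hdq)).add
        (hdp.const_mul κ)))).add (hdp.mul hw)).add (hp.mul hdw)).add (hdw.const_mul κ)
    exact ((((e1.add (e2.const_mul 4)).sub (hq.const_mul (6 * dδ))).sub
      (hdq.const_mul (6 * δ))).const_mul (1 / 3)).add (hdq.const_mul (2 * κ ^ 2))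
  unfold flowPrimitive
  exact (((((hw.sub ((hp.const_mul 2).mul hq)).mul hdp).sub (hE.div_const 8)).add
    (hS.const_mul (κ ^ 3 / 4))).const_mul (16 * dδ)).sub
    ((hdq.sub (hS.const_mul κ)).const_mul (2 * (2 * δ * dδ + 4 * dc)))

/-! ### The linearized operator and its quadratic form in flow variables. -/

section Operator

variable {α β μ t x₁ x₂ c dδ dc : ℝ} {p q w dp dq dw : ℝ → ℝ}

theorem gardnerPotential_eq_flowV
    (h : BreatherFlow (√2 * μ) (β ^ 2 - α ^ 2) c dδ dc p q w dp dq dw)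
    (hB : gardnerBreather α β μ t x₁ x₂ = fun x => 2 * √2 * p x) :
    deriv (gardnerBreather α β μ t x₁ x₂) = (fun x => 2 * √2 * (w x - 2 * p x * q x)) ∧
    gardnerPotential α β μ t x₁ x₂ =
      fun x => flowV (√2 * μ) (β ^ 2 - α ^ 2) (p x) (q x) (w x) := by
  have d1 : deriv (gardnerBreather α β μ t x₁ x₂) =
      fun x => 2 * √2 * (w x - 2 * p x * q x) := by
    rw [hB]; exact funext fun x => ((h.hasDerivAt_p x).const_mul _).deriv
  have d2 : iteratedDeriv 2 (gardnerBreather α β μ t x₁ x₂) =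
      fun x => 2 * √2 * flowP₂ (√2 * μ) (β ^ 2 - α ^ 2) (p x) (q x) (w x) := by
    rw [iteratedDeriv_succ, iteratedDeriv_one, d1]
    exact funext fun x => ((h.hasDerivAt_p₁ x).const_mul _).deriv
  refine ⟨d1, funext fun x => ?_⟩
  have hs : √2 ^ 2 = (2 : ℝ) := Real.sq_sqrt (by norm_num)
  simp only [gardnerPotential, d1, d2]
  simp only [hB]
  unfold flowV
  generalize flowP₂ (√2 * μ) (β ^ 2 - α ^ 2) (p x) (q x) (w x) = p2
  generalize √2 = s at *
  have hs4 : s ^ 4 = 4 := by rw [show s ^ 4 = (s ^ 2) ^ 2 by ring, hs]; norm_num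
  clear h hB d1 d2
  linear_combination (20 * (w x - 2 * p x * q x) ^ 2 + 40 * p x * p2 - 24 * (β ^ 2 - α ^ 2) * p x ^ 2
    + 240 * μ * s * p x ^ 3) * hs + 120 * p x ^ 4 * hs4

/-- With `B = 2√2 p` the coefficients become `5B² = 40p²` and `10μB = 20κp`, and `(α² + β²)² = δ² +
4α²β²`; `flowD₄` is arranged so that all terms but `flowRhs` cancel. -/
theorem gardnerL_eq_flowRhs
    (h : BreatherFlow (√2 * μ) (β ^ 2 - α ^ 2) (α ^ 2 * β ^ 2) dδ dc p q w dp dq dw)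
    (hB : gardnerBreather α β μ t x₁ x₂ = fun x => 2 * √2 * p x) :
    gardnerL α β μ t x₁ x₂ (fun x => 2 * √2 * dp x) =
      fun x => 2 * √2 * flowRhs (√2 * μ) (β ^ 2 - α ^ 2) dδ dc (p x) (q x) (w x) := by
  obtain ⟨b1, bV⟩ := gardnerPotential_eq_flowV h hB
  set κ := √2 * μ with hκ
  set δ := β ^ 2 - α ^ 2 with hδ
  have z1 : deriv (fun x => 2 * √2 * dp x) =
      fun x => 2 * √2 * flowD₁ (p x) (q x) (dp x) (dq x) (dw x) :=
    funext fun x => ((h.hasDerivAt_dp x).const_mul _).deriv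
  have z2 : iteratedDeriv 2 (fun x => 2 * √2 * dp x) =
      fun x => 2 * √2 * flowD₂ κ δ dδ (p x) (q x) (w x) (dp x) (dq x) (dw x) := by
    rw [iteratedDeriv_succ, iteratedDeriv_one, z1]
    exact funext fun x => ((h.hasDerivAt_D₁ x).const_mul _).deriv
  have z3 : iteratedDeriv 3 (fun x => 2 * √2 * dp x) =
      fun x => 2 * √2 * flowD₃ κ δ dδ (p x) (q x) (w x) (dp x) (dq x) (dw x) := by
    rw [iteratedDeriv_succ, z2]
    exact funext fun x => ((h.hasDerivAt_D₂ x).const_mul _).deriv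
  have z4 : iteratedDeriv 4 (fun x => 2 * √2 * dp x) =
      fun x => 2 * √2 * flowD₄ κ δ (α ^ 2 * β ^ 2) dδ dc (p x) (q x) (w x) (dp x) (dq x)
        (dw x) := by
    rw [iteratedDeriv_succ, z3]
    exact funext fun x => ((h.hasDerivAt_D₃ x).const_mul _).deriv
  funext x
  simp only [gardnerL, z4, z2, z1, bV, b1]
  simp only [hB]
  unfold flowD₄
  rw [← hδ, show (α ^ 2 + β ^ 2) ^ 2 = δ ^ 2 + 4 * (α ^ 2 * β ^ 2) by rw [hδ]; ring]
  generalize flowV κ δ (p x) (q x) (w x) = V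
  generalize flowD₂ κ δ dδ (p x) (q x) (w x) (dp x) (dq x) (dw x) = D2
  generalize flowD₁ (p x) (q x) (dp x) (dq x) (dw x) = D1
  generalize flowRhs κ δ dδ dc (p x) (q x) (w x) = R
  have hs : √2 ^ 2 = (2 : ℝ) := Real.sq_sqrt (by norm_num)
  have e1 : (2 * √2 * p x) ^ 2 = 8 * p x ^ 2 := by linear_combination 4 * p x ^ 2 * hs
  have e2 : 10 * (2 * √2 * p x) * (2 * √2 * (w x - 2 * p x * q x)) =
      80 * p x * (w x - 2 * p x * q x) := by
    linear_combination 40 * p x * (w x - 2 * p x * q x) * hs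
  rw [e1, e2, hκ]
  ring

variable {b db r : ℝ}

theorem memH2_of_breatherFlow {κ δ : ℝ} (h : BreatherFlow κ δ c dδ dc p q w dp dq dw)
    (hr : 0 < r)
    (hT : BreatherAsymptotics atTop r b db p q w dp dq dw)
    (hT' : BreatherAsymptotics atBot r (-b) (-db) p q w dp dq dw) (s : ℝ) :
    MemH2 (fun x => s * dp x) ∧
      weakDeriv (fun x => s * dp x) =ᵐ[volume]
        (fun x => s * flowD₁ (p x) (q x) (dp x) (dq x) (dw x)) ∧
      weakDeriv (weakDeriv (fun x => s * dp x)) =ᵐ[volume]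
        (fun x => s * flowD₂ κ δ dδ (p x) (q x) (w x) (dp x) (dq x) (dw x)) := by
  obtain ⟨cp, cq, cw, cdp, cdq, cdw⟩ := h.continuous_all
  have c1 : Continuous (fun x => flowD₁ (p x) (q x) (dp x) (dq x) (dw x)) := by
    unfold flowD₁; fun_prop
  have c2 : Continuous (fun x => flowD₂ κ δ dδ (p x) (q x) (w x) (dp x) (dq x) (dw x)) := by
    unfold flowD₂; fun_prop
  have w1 : HasWeakDeriv (fun x => s * dp x)
      (fun x => s * flowD₁ (p x) (q x) (dp x) (dq x) (dw x)) :=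
    hasWeakDeriv_of_hasDerivAt (fun x => (h.hasDerivAt_dp x).const_mul s) (c1.const_mul s)
  have w2 : HasWeakDeriv (fun x => s * flowD₁ (p x) (q x) (dp x) (dq x) (dw x))
      (fun x => s * flowD₂ κ δ dδ (p x) (q x) (w x) (dp x) (dq x) (dw x)) :=
    hasWeakDeriv_of_hasDerivAt (fun x => (h.hasDerivAt_D₁ x).const_mul s) (c2.const_mul s)
  have m0 := (memLp_two_of_expTendsto_zero hr cdp hT.dp hT'.dp).const_mul s
  have m1 := (memLp_two_of_expTendsto_zero hr c1 (hT.D₁ hr.le) (hT'.D₁ hr.le)).const_mul s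
  have m2 := (memLp_two_of_expTendsto_zero hr c2 (hT.D₂ hr.le κ δ dδ)
    (hT'.D₂ hr.le κ δ dδ)).const_mul s
  exact ⟨⟨m0, _, m1, w1, _, m2, w2⟩, w1.weakDeriv_ae_eq,
    (w2.congr_ae w1.weakDeriv_ae_eq.symm).weakDeriv_ae_eq⟩

theorem integral_mul_gardnerL
    (h : BreatherFlow (√2 * μ) (β ^ 2 - α ^ 2) (α ^ 2 * β ^ 2) dδ dc p q w dp dq dw)
    (hB : gardnerBreather α β μ t x₁ x₂ = fun x => 2 * √2 * p x) (hr : 0 < r)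
    (hT : BreatherAsymptotics atTop r b db p q w dp dq dw)
    (hT' : BreatherAsymptotics atBot r (-b) (-db) p q w dp dq dw)
    {S : ℝ → ℝ} (hS : ∀ x, HasDerivAt S (dp x) x) {σ τ : ℝ} (hσ : Tendsto S atTop (𝓝 σ))
    (hτ : Tendsto S atBot (𝓝 τ)) :
    Integrable (fun x => 2 * √2 * dp x *
      gardnerL α β μ t x₁ x₂ (fun x => 2 * √2 * dp x) x) ∧
    (∫ x, 2 * √2 * dp x * gardnerL α β μ t x₁ x₂ (fun x => 2 * √2 * dp x) x) =
      flowPrimitive (√2 * μ) (β ^ 2 - α ^ 2) dδ dc 0 b 0 0 db 0 σ -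
        flowPrimitive (√2 * μ) (β ^ 2 - α ^ 2) dδ dc 0 (-b) 0 0 (-db) 0 τ := by
  obtain ⟨cp, cq, cw, cdp, cdq, cdw⟩ := h.continuous_all
  have hs : √2 ^ 2 = (2 : ℝ) := Real.sq_sqrt (by norm_num)
  have e : (fun x => 2 * √2 * dp x * gardnerL α β μ t x₁ x₂ (fun x => 2 * √2 * dp x) x) =
      fun x => 8 * (dp x * flowRhs (√2 * μ) (β ^ 2 - α ^ 2) dδ dc (p x) (q x) (w x)) := by
    rw [gardnerL_eq_flowRhs h hB]
    funext x
    linear_combination (4 * dp x *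
      flowRhs (√2 * μ) (β ^ 2 - α ^ 2) dδ dc (p x) (q x) (w x)) * hs
  have hi : Integrable (fun x => 8 * (dp x *
      flowRhs (√2 * μ) (β ^ 2 - α ^ 2) dδ dc (p x) (q x) (w x))) := by
    refine (integrable_of_expTendsto_zero hr ?_ ?_ ?_).const_mul 8
    · unfold flowRhs flowP₂; fun_prop
    · exact (hT.dp.mul hr.le (hT.flowRhs hr.le _ _ _ _)).congr (fun _ => rfl) (mul_zero 0)
    · exact (hT'.dp.mul hr.le (hT'.flowRhs hr.le _ _ _ _)).congr (fun _ => rfl) (mul_zero 0)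
  rw [e]
  exact ⟨hi, integral_of_hasDerivAt_of_tendsto (h.hasDerivAt_primitive hS) hi
    (hT'.tendsto_primitive tendsto_abs_atBot_atTop hr hτ) (hT.tendsto_primitive tendsto_abs_atTop_atTop hr hσ)⟩

theorem gardnerQ_eq_integral_mul_gardnerL
    (h : BreatherFlow (√2 * μ) (β ^ 2 - α ^ 2) (α ^ 2 * β ^ 2) dδ dc p q w dp dq dw)
    (hB : gardnerBreather α β μ t x₁ x₂ = fun x => 2 * √2 * p x) (hr : 0 < r)
    (hT : BreatherAsymptotics atTop r b db p q w dp dq dw)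
    (hT' : BreatherAsymptotics atBot r (-b) (-db) p q w dp dq dw)
    (hL : Integrable (fun x => 2 * √2 * dp x *
      gardnerL α β μ t x₁ x₂ (fun x => 2 * √2 * dp x) x)) :
    gardnerQ α β μ t x₁ x₂ (fun x => 2 * √2 * dp x) =
      ∫ x, 2 * √2 * dp x * gardnerL α β μ t x₁ x₂ (fun x => 2 * √2 * dp x) x := by
  obtain ⟨cp, cq, cw, cdp, cdq, cdw⟩ := h.continuous_all
  obtain ⟨-, hw1, hw2⟩ := memH2_of_breatherFlow h hr hT hT' (2 * √2)
  have hpot := (gardnerPotential_eq_flowV h hB).2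
  rw [gardnerL_eq_flowRhs h hB] at hL ⊢
  have hs : √2 ^ 2 = (2 : ℝ) := Real.sq_sqrt (by norm_num)
  set κ := √2 * μ with hκ
  set δ := β ^ 2 - α ^ 2 with hδ
  let D1 := fun x => flowD₁ (p x) (q x) (dp x) (dq x) (dw x)
  let D2 := fun x => flowD₂ κ δ dδ (p x) (q x) (w x) (dp x) (dq x) (dw x)
  let D3 := fun x => flowD₃ κ δ dδ (p x) (q x) (w x) (dp x) (dq x) (dw x)
  let V := fun x => flowV κ δ (p x) (q x) (w x)
  let R := fun x => flowRhs κ δ dδ dc (p x) (q x) (w x)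
  let g := fun x => D2 x ^ 2 + (2 * δ - 40 * p x ^ 2 - 20 * κ * p x) * D1 x ^ 2
    + ((δ ^ 2 + 4 * (α ^ 2 * β ^ 2)) + V x) * dp x ^ 2
  have hQ : gardnerQ α β μ t x₁ x₂ (fun x => 2 * √2 * dp x) = ∫ x, 8 * g x := by
    unfold gardnerQ
    refine integral_congr_ae ?_
    filter_upwards [hw1, hw2] with x h1 h2
    simp only [h1, h2, hpot, hB, ← hδ]
    change _ = 8 * (D2 x ^ 2 + (2 * δ - 40 * p x ^ 2 - 20 * κ * p x) * D1 x ^ 2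
      + ((δ ^ 2 + 4 * (α ^ 2 * β ^ 2)) + V x) * dp x ^ 2)
    change (2 * √2 * D2 x) ^ 2 + (2 * δ - 5 * (2 * √2 * p x) ^ 2 - 10 * μ * (2 * √2 * p x)) *
      (2 * √2 * D1 x) ^ 2 + ((α ^ 2 + β ^ 2) ^ 2 + V x) * (2 * √2 * dp x) ^ 2 = _
    rw [show (α ^ 2 + β ^ 2) ^ 2 = δ ^ 2 + 4 * (α ^ 2 * β ^ 2) by rw [hδ]; ring, hκ]
    have e (y : ℝ) : (2 * √2 * y) ^ 2 = 8 * y ^ 2 := by linear_combination 4 * y ^ 2 * hs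
    rw [e, e, e, e]
    ring
  have hLe : ∀ x, 2 * √2 * dp x * (2 * √2 * flowRhs κ δ dδ dc (p x) (q x) (w x)) =
      8 * (dp x * R x) := fun x => by
    change 2 * √2 * dp x * (2 * √2 * R x) = _
    linear_combination (4 * dp x * R x) * hs
  simp only [hLe] at hL ⊢
  rw [hQ]
  have hc (l : Filter ℝ) (a : ℝ) : ExpTendsto l r (fun _ => a) a := ExpTendsto.const a
  have hg0 : ∀ {l : Filter ℝ} {b db : ℝ}, BreatherAsymptotics l r b db p q w dp dq dw →
      ExpTendsto l r g 0 := by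
    intro l b db hA
    have e1 := hA.D₁ hr.le
    have e2 := hA.D₂ hr.le κ δ dδ
    have e3 := hA.flowV hr.le κ δ
    have := ((e2.mul hr.le e2).add (((((hc l (2 * δ)).sub ((hc l 40).mul hr.le
      (hA.p.mul hr.le hA.p))).sub ((hc l (20 * κ)).mul hr.le hA.p))).mul hr.le
      (e1.mul hr.le e1))).add (((hc l (δ ^ 2 + 4 * (α ^ 2 * β ^ 2))).add e3).mul hr.le
      (hA.dp.mul hr.le hA.dp))
    refine this.congr (fun x => ?_) (by ring)
    change D2 x * D2 x + _ * (D1 x * D1 x) + (_ + V x) * _ = D2 x ^ 2 + (2 * δ - 40 * p x ^ 2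
      - 20 * κ * p x) * D1 x ^ 2 + ((δ ^ 2 + 4 * (α ^ 2 * β ^ 2)) + V x) * dp x ^ 2
    ring
  have cg : Continuous g := by
    simp only [g, D2, D1, V]
    unfold flowD₁ flowD₂ flowV flowP₂
    fun_prop
  have ig : Integrable g := integrable_of_expTendsto_zero hr cg (hg0 hT) (hg0 hT')
  -- For `z = 2√2 dp`, `8Y = z z_xxx - z_x z_xx + (5B² + 10μB - 2δ) z z_x` collects the boundary
  -- terms of the integrations by parts; it vanishes at both ends.
  let Y := fun x => dp x * D3 x - D1 x * D2 x
    + (40 * p x ^ 2 + 20 * κ * p x - 2 * δ) * (dp x * D1 x)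
  have hY : ∀ x, HasDerivAt Y (dp x * R x - g x) x := by
    intro x
    have hp := h.hasDerivAt_p x
    have hd := h.hasDerivAt_dp x
    have hd1 : HasDerivAt D1 (D2 x) x := h.hasDerivAt_D₁ x
    have hd2 : HasDerivAt D2 (D3 x) x := h.hasDerivAt_D₂ x
    have hd3 : HasDerivAt D3 _ x := h.hasDerivAt_D₃ x
    have hd' : HasDerivAt dp (D1 x) x := hd
    refine (((hd'.mul hd3).sub (hd1.mul hd2)).add (((((hp.pow 2).const_mul 40).add
      (hp.const_mul (20 * κ))).sub_const (2 * δ)).mul (hd'.mul hd1))).congr_deriv ?_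
    simp only [Pi.mul_apply, Pi.pow_apply, Pi.add_apply]
    unfold flowD₄
    change D1 x * D3 x + dp x * (R x + 2 * δ * D2 x - (δ ^ 2 + 4 * (α ^ 2 * β ^ 2)) * dp x
      - 40 * p x ^ 2 * D2 x - 80 * p x * (w x - 2 * p x * q x) * D1 x
      - 20 * κ * p x * D2 x - 20 * κ * (w x - 2 * p x * q x) * D1 x - V x * dp x)
      - (D2 x * D2 x + D1 x * D3 x) + _ = dp x * R x - (D2 x ^ 2 + (2 * δ - 40 * p x ^ 2
      - 20 * κ * p x) * D1 x ^ 2 + ((δ ^ 2 + 4 * (α ^ 2 * β ^ 2)) + V x) * dp x ^ 2)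
    push_cast
    ring
  have hY0 : ∀ {l : Filter ℝ} {b db : ℝ}, Tendsto (fun x : ℝ => |x|) l atTop →
      BreatherAsymptotics l r b db p q w dp dq dw → Tendsto Y l (𝓝 0) := by
    intro l b db hl hA
    have e0 := hA.dp.tendsto hl hr
    have ep := hA.p.tendsto hl hr
    have e1 : Tendsto D1 l (𝓝 0) := (hA.D₁ hr.le).tendsto hl hr
    have e2 : Tendsto D2 l (𝓝 0) := (hA.D₂ hr.le κ δ dδ).tendsto hl hr
    have e3 : Tendsto D3 l (𝓝 0) := (hA.D₃ hr.le κ δ dδ).tendsto hl hr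
    have := ((e0.mul e3).sub (e1.mul e2)).add (((((ep.pow 2).const_mul 40).add
      (ep.const_mul (20 * κ))).sub_const (2 * δ)).mul (e0.mul e1))
    simpa using this
  have hL' : Integrable (fun x => dp x * R x) := by
    have := hL.const_mul (1 / 8)
    refine this.congr (Eventually.of_forall fun x => ?_)
    change 1 / 8 * (8 * (dp x * R x)) = dp x * R x
    ring
  have h0 := integral_of_hasDerivAt_of_tendsto hY (hL'.sub ig) (hY0 tendsto_abs_atBot_atTop hT')
    (hY0 tendsto_abs_atTop_atTop hT)
  rw [integral_sub hL' ig] at h0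
  rw [integral_const_mul, integral_const_mul]
  linarith

end Operator

/-! ### Bilinear identities for sums of four exponentials. -/

/-- The `k`-th derivative of the sum of exponentials with exponents `b, -b, a, -a` and
coefficients `A, C, P, M`; here `E`, `E'`, `U`, `U'` are the values of the exponentials. -/
def tauSum (A C P M a b E E' U U' : ℂ) (k : ℕ) : ℂ :=
  A * b ^ k * E + C * (-b) ^ k * E' + P * a ^ k * U + M * (-a) ^ k * U'

/-- Here `a` and `κ` stand for `iα` and `i√2 μ`, and `K` for the conjugate of `H`. Multiplication by
`(2DEU)²` turns each identity into a polynomial one. All products of exponentials cancel by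
themselves except the constant mode, which carries `E²U²` and vanishes by the normalization of `G`.
-/
theorem tau_bilinear {a b κ G E E' U U' D : ℂ} (hD : D = b ^ 2 + κ ^ 2 - a ^ 2) (hD0 : D ≠ 0)
    (hE : E * E' = 1) (hU : U * U' = 1) (hG : -G ^ 2 * a ^ 2 * (b ^ 2 - a ^ 2) * D = 1)
    {H K : ℕ → ℂ}
    (hH : H = tauSum (1 / 2 - b * κ / D) (1 / 2) (b * G / 2 * (b ^ 2 - a ^ 2 + κ * a - κ * b))
      (b * G / 2 * (κ * a + κ * b - b ^ 2 + a ^ 2)) a b E E' U U')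
    (hK : K = tauSum (1 / 2 + b * κ / D) (1 / 2) (b * G / 2 * (b ^ 2 - a ^ 2 + κ * a + κ * b))
      (b * G / 2 * (κ * a - κ * b - b ^ 2 + a ^ 2)) (-a) b E E' U' U) :
    (H 2 * K 0 + H 0 * K 2 - 2 * (H 1 * K 1) + κ * (H 1 * K 0 - H 0 * K 1) = 0) ∧
    (H 3 * K 0 - H 0 * K 3 - (b ^ 2 + a ^ 2) * (H 1 * K 0 - H 0 * K 1)
      - (H 2 * K 1 - H 1 * K 2) = 0) ∧
    (2 * (H 2 * K 2) + 2 * a ^ 2 * b ^ 2 * (H 0 * K 0)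
      - (b ^ 2 + a ^ 2) * ((H 2 * K 0 + H 0 * K 2) + κ * (H 1 * K 0 - H 0 * K 1))
      - 2 * κ * (H 2 * K 1 - H 1 * K 2) = 0) := by
  have hE0 : E ≠ 0 := left_ne_zero_of_mul_eq_one hE
  have hU0 : U ≠ 0 := left_ne_zero_of_mul_eq_one hU
  obtain rfl : E' = E⁻¹ := eq_inv_of_mul_eq_one_right hE
  obtain rfl : U' = U⁻¹ := eq_inv_of_mul_eq_one_right hU
  have eH : ∀ k, 2 * D * E * U * H k = (D - 2 * b * κ) * b ^ k * E ^ 2 * U + D * (-b) ^ k * U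
      + D * b * G * ((b ^ 2 - a ^ 2 + κ * a - κ * b) * a ^ k * U ^ 2
        + (κ * a + κ * b - b ^ 2 + a ^ 2) * (-a) ^ k) * E := by
    intro k
    rw [hH, tauSum]
    field_simp
    ring
  have eK : ∀ k, 2 * D * E * U * K k = (D + 2 * b * κ) * b ^ k * E ^ 2 * U + D * (-b) ^ k * U
      + D * b * G * ((b ^ 2 - a ^ 2 + κ * a + κ * b) * (-a) ^ k
        + (κ * a - κ * b - b ^ 2 + a ^ 2) * a ^ k * U ^ 2) * E := by
    intro k
    rw [hK, tauSum]
    field_simp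
    ring
  have hne : 2 * D * E * U ≠ 0 := by simp [hD0, hE0, hU0]
  generalize 2 * D * E * U = N at hne eH eK
  subst hD
  have h0 := eH 0
  have h1 := eH 1
  have h2 := eH 2
  have h3 := eH 3
  have k0 := eK 0
  have k1 := eK 1
  have k2 := eK 2
  have k3 := eK 3
  refine ⟨?_, ?_, ?_⟩
  · have : N ^ 2 * (H 2 * K 0 + H 0 * K 2 - 2 * (H 1 * K 1) + κ * (H 1 * K 0 - H 0 * K 1)) = 0 := by
      rw [show N ^ 2 * (H 2 * K 0 + H 0 * K 2 - 2 * (H 1 * K 1) + κ * (H 1 * K 0 - H 0 * K 1)) =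
        (N * H 2) * (N * K 0) + (N * H 0) * (N * K 2) - 2 * ((N * H 1) * (N * K 1))
        + κ * ((N * H 1) * (N * K 0) - (N * H 0) * (N * K 1)) by ring, h0, h1, h2, k0, k1, k2]
      linear_combination (-2 * b ^ 2 * (b ^ 2 - a ^ 2) * 4 * (b ^ 2 + κ ^ 2 - a ^ 2)
        * E ^ 2 * U ^ 2) * hG
    simpa [hne] using this
  · have : N ^ 2 * (H 3 * K 0 - H 0 * K 3 - (b ^ 2 + a ^ 2) * (H 1 * K 0 - H 0 * K 1)
      - (H 2 * K 1 - H 1 * K 2)) = 0 := by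
      rw [show N ^ 2 * (H 3 * K 0 - H 0 * K 3 - (b ^ 2 + a ^ 2) * (H 1 * K 0 - H 0 * K 1)
        - (H 2 * K 1 - H 1 * K 2)) =
        (N * H 3) * (N * K 0) - (N * H 0) * (N * K 3) - (b ^ 2 + a ^ 2) *
        ((N * H 1) * (N * K 0) - (N * H 0) * (N * K 1)) -
        ((N * H 2) * (N * K 1) - (N * H 1) * (N * K 2)) by ring, h0, h1, h2, k0, k1, k2, h3, k3]
      linear_combination (2 * b ^ 2 * κ * (b ^ 2 - a ^ 2) * 4 * (b ^ 2 + κ ^ 2 - a ^ 2)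
        * E ^ 2 * U ^ 2) * hG
    simpa [hne] using this
  · have : N ^ 2 * (2 * (H 2 * K 2) + 2 * a ^ 2 * b ^ 2 * (H 0 * K 0)
      - (b ^ 2 + a ^ 2) * ((H 2 * K 0 + H 0 * K 2) + κ * (H 1 * K 0 - H 0 * K 1))
      - 2 * κ * (H 2 * K 1 - H 1 * K 2)) = 0 := by
      rw [show N ^ 2 * (2 * (H 2 * K 2) + 2 * a ^ 2 * b ^ 2 * (H 0 * K 0)
        - (b ^ 2 + a ^ 2) * ((H 2 * K 0 + H 0 * K 2) + κ * (H 1 * K 0 - H 0 * K 1))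
        - 2 * κ * (H 2 * K 1 - H 1 * K 2)) = 2 * ((N * H 2) * (N * K 2))
        + 2 * a ^ 2 * b ^ 2 * ((N * H 0) * (N * K 0))
        - (b ^ 2 + a ^ 2) * (((N * H 2) * (N * K 0) + (N * H 0) * (N * K 2))
          + κ * ((N * H 1) * (N * K 0) - (N * H 0) * (N * K 1)))
        - 2 * κ * ((N * H 2) * (N * K 1) - (N * H 1) * (N * K 2)) by ring,
        h0, h1, h2, k0, k1, k2]
      linear_combination (2 * b ^ 2 * κ ^ 2 * (b ^ 2 - a ^ 2) * 4 * (b ^ 2 + κ ^ 2 - a ^ 2)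
        * E ^ 2 * U ^ 2) * hG
    simpa [hne] using this

/-! ### Exponential modes and asymptotics under a dominant mode. -/

/-- The `k`-th `x`-derivative of `C exp (ν (x + η))`. -/
def expMode (C ν : ℂ) (η : ℝ) (k : ℕ) (x : ℝ) : ℂ :=
  C * ν ^ k * Complex.exp (ν * ((x + η : ℝ) : ℂ))

/-- The derivative of `expMode C ν η k x` with respect to a parameter on which `C`, `ν`, `η`
depend with derivatives `C'`, `ν'`, `η'`. -/
def expModeDot (C ν C' ν' : ℂ) (η η' : ℝ) (k : ℕ) (x : ℝ) : ℂ :=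
  (C' * ν ^ k + C * (k * ν ^ (k - 1) * ν')
    + C * ν ^ k * (ν' * ((x + η : ℝ) : ℂ) + ν * (η' : ℂ))) * Complex.exp (ν * ((x + η : ℝ) : ℂ))

theorem hasDerivAt_ofReal_add (η x : ℝ) :
    HasDerivAt (fun x : ℝ => ((x + η : ℝ) : ℂ)) 1 x := by
  simpa using ((hasDerivAt_id x).add_const η).ofReal_comp

theorem hasDerivAt_expMode (C ν : ℂ) (η : ℝ) (k : ℕ) (x : ℝ) :
    HasDerivAt (expMode C ν η k) (expMode C ν η (k + 1) x) x := by
  have h := (((hasDerivAt_ofReal_add η x).const_mul ν).cexp).const_mul (C * ν ^ k)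
  refine h.congr_deriv ?_
  unfold expMode; ring

theorem hasDerivAt_expModeDot (C ν C' ν' : ℂ) (η η' : ℝ) (k : ℕ) (x : ℝ) :
    HasDerivAt (expModeDot C ν C' ν' η η' k) (expModeDot C ν C' ν' η η' (k + 1) x) x := by
  have h0 := hasDerivAt_ofReal_add η x
  have h1 := ((((h0.const_mul ν').add_const (ν * (η' : ℂ))).const_mul (C * ν ^ k)).const_add
    (C' * ν ^ k + C * (k * ν ^ (k - 1) * ν'))).mul (h0.const_mul ν).cexp
  refine h1.congr_deriv ?_
  -- The truncated exponent `k - 1` at `k = 0` is harmless because of the factor `k`.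
  have hk : (k : ℂ) * ν ^ (k - 1) * ν = k * ν ^ k := by
    cases k with
    | zero => simp
    | succ n => simp [pow_succ]; ring
  unfold expModeDot
  simp only [Nat.add_sub_cancel]
  push_cast
  linear_combination (C * ν' * Complex.exp (ν * ((x : ℂ) + η))) * hk

theorem hasDerivAt_expMode_param {C ν : ℝ → ℂ} {η : ℝ → ℝ} {C' ν' : ℂ} {η' θ : ℝ}
    (hC : HasDerivAt C C' θ) (hν : HasDerivAt ν ν' θ) (hη : HasDerivAt η η' θ) (k : ℕ) (x : ℝ) :
    HasDerivAt (fun s => expMode (C s) (ν s) (η s) k x)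
      (expModeDot (C θ) (ν θ) C' ν' (η θ) η' k x) θ := by
  have h0 : HasDerivAt (fun s => ((x + η s : ℝ) : ℂ)) (η' : ℂ) θ := (hη.const_add x).ofReal_comp
  refine ((hC.mul (hν.pow k)).mul (hν.mul h0).cexp).congr_deriv ?_
  simp only [Pi.mul_apply, Pi.pow_apply]
  unfold expModeDot
  ring

theorem isBigO_expMode {l : Filter ℝ} {ν : ℂ} (hν : ∀ᶠ x : ℝ in l, ν.re * x ≤ 0) (C : ℂ) (η : ℝ)
    (k : ℕ) : expMode C ν η k =O[l] fun _ => (1 : ℝ) := by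
  refine IsBigO.of_bound (‖C * ν ^ k‖ * Real.exp (ν.re * η)) ?_
  filter_upwards [hν] with x hx
  rw [expMode, norm_mul, Complex.norm_exp]
  simp only [norm_one, mul_one, Complex.re_mul_ofReal]
  refine mul_le_mul_of_nonneg_left (Real.exp_le_exp.2 ?_) (norm_nonneg _)
  rw [mul_add]
  linarith

theorem isBigO_one_add_abs (l : Filter ℝ) :
    (fun _ : ℝ => (1 : ℝ)) =O[l] fun x : ℝ => 1 + |x| := by
  refine IsBigO.of_bound 1 (Eventually.of_forall fun x => ?_)
  rw [Real.norm_of_nonneg (by positivity), Real.norm_of_nonneg (by positivity)]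
  linarith [abs_nonneg x]

theorem isBigO_id_one_add_abs (l : Filter ℝ) (ν' ν : ℂ) (η η' : ℝ) :
    (fun x : ℝ => ν' * ((x + η : ℝ) : ℂ) + ν * (η' : ℂ)) =O[l] fun x : ℝ => 1 + |x| := by
  have h1 : (fun x : ℝ => ((x : ℝ) : ℂ)) =O[l] fun x : ℝ => 1 + |x| := by
    refine IsBigO.of_bound 1 (Eventually.of_forall fun x => ?_)
    rw [Real.norm_of_nonneg (by positivity : 0 ≤ 1 + |x|)]
    simp
  have hc (c : ℂ) : (fun _ : ℝ => c) =O[l] fun x : ℝ => 1 + |x| :=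
    (isBigO_const_const c (one_ne_zero (α := ℝ)) l).trans (isBigO_one_add_abs l)
  refine (((h1.add (hc η)).const_mul_left ν').add (hc (ν * η'))).congr_left fun x => ?_
  push_cast; ring

theorem isBigO_expModeDot {l : Filter ℝ} {ν : ℂ} (hν : ∀ᶠ x : ℝ in l, ν.re * x ≤ 0)
    (C C' ν' : ℂ) (η η' : ℝ) (k : ℕ) :
    expModeDot C ν C' ν' η η' k =O[l] fun x : ℝ => 1 + |x| := by
  have h1 := isBigO_expMode hν 1 η 0
  have h2 := isBigO_id_one_add_abs l ν' ν η η'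
  have hc : (fun _ : ℝ => C' * ν ^ k + C * (k * ν ^ (k - 1) * ν')) =O[l]
      fun x : ℝ => 1 + |x| :=
    (isBigO_const_const _ (one_ne_zero (α := ℝ)) l).trans (isBigO_one_add_abs l)
  refine ((hc.add (h2.const_mul_left (C * ν ^ k))).mul h1).congr (fun x => ?_) fun x => ?_
  · simp [expMode, expModeDot]
  · simp

/-- Differentiating an exponential in its exponent produces a factor linear in `x`; half of the
decay rate is spent on absorbing it. -/
theorem isBigO_one_add_abs_mul_exp {b : ℝ} (hb : 0 < b) (l : Filter ℝ) :
    (fun x : ℝ => (1 + |x|) * Real.exp (-b * |x|)) =O[l] fun x => Real.exp (-(b / 2) * |x|) := by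
  refine IsBigO.of_bound (1 + 2 / b) (Eventually.of_forall fun x => ?_)
  have hx := abs_nonneg x
  rw [Real.norm_of_nonneg (by positivity), Real.norm_of_nonneg (by positivity)]
  have e : Real.exp (-b * |x|) = Real.exp (-(b / 2) * |x|) * Real.exp (-(b / 2) * |x|) := by
    rw [← Real.exp_add]; congr 1; ring
  have h1 : b / 2 * |x| + 1 ≤ Real.exp (b / 2 * |x|) := Real.add_one_le_exp _
  have h2 : Real.exp (b / 2 * |x|) * Real.exp (-(b / 2) * |x|) = 1 := by
    rw [← Real.exp_add]; simp
  have h3 : 1 + |x| ≤ (1 + 2 / b) * Real.exp (b / 2 * |x|) := by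
    refine le_trans ?_ (mul_le_mul_of_nonneg_left h1 (by positivity))
    have : (1 + 2 / b) * (b / 2 * |x| + 1) = 1 + |x| + (b / 2 * |x| + 2 / b) := by
      field_simp; ring
    rw [this]
    have : 0 ≤ b / 2 * |x| + 2 / b := by positivity
    linarith
  calc (1 + |x|) * Real.exp (-b * |x|)
      ≤ (1 + 2 / b) * Real.exp (b / 2 * |x|) * Real.exp (-b * |x|) := by gcongr
    _ = (1 + 2 / b) * (Real.exp (b / 2 * |x|) * Real.exp (-(b / 2) * |x|))
        * Real.exp (-(b / 2) * |x|) := by rw [e]; ring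
    _ = (1 + 2 / b) * Real.exp (-(b / 2) * |x|) := by rw [h2, mul_one]

/-- Asymptotics of the logarithmic derivatives of a sum of exponentials with one dominant mode
with exponent `ν = ε b`, and of their derivatives with respect to a parameter. -/
theorem expTendsto_of_dominant_mode {l : Filter ℝ} {b ν : ℝ} (hb : 0 < b)
    (hl : Tendsto (fun x : ℝ => |x|) l atTop) (hν : ∀ᶠ x in l, ν * x = b * |x|)
    {A A' : ℂ} (hA : A ≠ 0) {ν' η η' : ℝ} {H K R T : ℕ → ℝ → ℂ}
    (hH : ∀ k x, H k x = expMode A ν η k x + R k x)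
    (hK : ∀ k x, K k x = expModeDot A ν A' ν' η η' k x + T k x)
    (hR : ∀ k, R k =O[l] fun _ => (1 : ℝ)) (hT : ∀ k, T k =O[l] fun x => 1 + |x|)
    (hH0 : ∀ x, H 0 x ≠ 0) :
    (∀ k, ExpTendsto l (b / 2) (fun x => H k x / H 0 x) ((ν : ℂ) ^ k)) ∧
    (∀ k, ExpTendsto l (b / 2) (fun x => K k x / H 0 x - H k x / H 0 x * (K 0 x / H 0 x))
      (k * (ν : ℂ) ^ (k - 1) * ν')) ∧
    Tendsto (fun x => (K 0 x / H 0 x).im) l (𝓝 (A' / A).im) := by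
  have hnorm : ∀ x, ‖expMode A ν η 0 x‖ = ‖A‖ * Real.exp (ν * η) * Real.exp (ν * x) := by
    intro x
    rw [expMode, norm_mul, Complex.norm_exp, mul_assoc, ← Real.exp_add]
    simp [mul_add, add_comm]
  have hA' : 0 < ‖A‖ * Real.exp (ν * η) := by positivity
  have hone : (fun _ : ℝ => (1 : ℝ)) =o[l] expMode A ν η 0 := by
    rw [isLittleO_const_left]
    right
    have : Tendsto (fun x : ℝ => ‖A‖ * Real.exp (ν * η) * Real.exp (b * |x|)) l atTop :=
      (Real.tendsto_exp_atTop.comp (hl.const_mul_atTop hb)).const_mul_atTop hA'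
    refine this.congr' ?_
    filter_upwards [hν] with x hx
    simp [hnorm, hx]
  have hdom : expMode A ν η 0 =O[l] H 0 := by
    have h := ((hR 0).trans_isLittleO hone).right_isBigO_add
    refine h.congr_right fun x => ?_
    rw [hH 0 x]; ring
  have hmode : expMode A ν η 0 =O[l] fun x => Real.exp (b * |x|) := by
    refine IsBigO.of_bound (‖A‖ * Real.exp (ν * η)) ?_
    filter_upwards [hν] with x hx
    rw [hnorm, hx, Real.norm_of_nonneg (Real.exp_pos _).le]
  have hinv : (fun x => (H 0 x)⁻¹) =O[l] fun x => Real.exp (-b * |x|) := by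
    have h1 := hdom.inv_rev (Eventually.of_forall fun x hx => by
      exact absurd hx (by simp [expMode, hA]))
    refine h1.trans (IsBigO.of_bound (‖A‖ * Real.exp (ν * η))⁻¹ ?_)
    filter_upwards [hν] with x hx
    rw [norm_inv, hnorm, hx, mul_inv, Real.norm_of_nonneg (Real.exp_pos _).le, ← Real.exp_neg,
      neg_mul]
  have hone_abs := isBigO_one_add_abs l
  have hexp := isBigO_one_add_abs_mul_exp hb l
  have hquot : ∀ f : ℝ → ℂ, (f =O[l] fun x => 1 + |x|) →
      (fun x => f x * (H 0 x)⁻¹) =O[l] fun x => Real.exp (-(b / 2) * |x|) :=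
    fun f hf => (hf.mul hinv).trans hexp
  have hr : ∀ k x, H k x / H 0 x - (ν : ℂ) ^ k = (R k x - (ν : ℂ) ^ k * R 0 x) * (H 0 x)⁻¹ := by
    intro k x
    have e : H k x - (ν : ℂ) ^ k * H 0 x = R k x - (ν : ℂ) ^ k * R 0 x := by
      rw [hH, hH]; unfold expMode; ring
    rw [← e]
    field_simp [hH0 x]
  have hr1 : ∀ k, (fun x => R k x - (ν : ℂ) ^ k * R 0 x) =O[l] fun _ => (1 : ℝ) :=
    fun k => (hR k).sub ((hR 0).const_mul_left _)
  have hK0 : K 0 =O[l] fun x => (1 + |x|) * Real.exp (b * |x|) := by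
    have h1 : expModeDot A ν A' ν' η η' 0 =O[l] fun x => (1 + |x|) * Real.exp (b * |x|) := by
      have hc : (fun _ : ℝ => A' / A) =O[l] fun x : ℝ => 1 + |x| :=
        (isBigO_const_const _ (one_ne_zero (α := ℝ)) l).trans hone_abs
      refine ((hc.add (isBigO_id_one_add_abs l (ν' : ℂ) ν η η')).mul hmode).congr_left
        fun x => ?_
      simp only [expMode, expModeDot]
      field_simp
      simp
    have h2 : (fun x : ℝ => 1 + |x|) =O[l] fun x => (1 + |x|) * Real.exp (b * |x|) := by
      refine IsBigO.of_bound 1 (Eventually.of_forall fun x => ?_)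
      have hx := abs_nonneg x
      rw [Real.norm_of_nonneg (by positivity), Real.norm_of_nonneg (by positivity), one_mul]
      exact le_mul_of_one_le_right (by positivity) (Real.one_le_exp (by positivity))
    refine (h1.add ((hT 0).trans h2)).congr_left fun x => (hK 0 x).symm
  have hσ : (fun x => K 0 x / H 0 x) =O[l] fun x => 1 + |x| := by
    refine (hK0.mul hinv).congr (fun x => (div_eq_mul_inv _ _).symm) fun x => ?_
    rw [mul_assoc, ← Real.exp_add]; simp
  refine ⟨fun k => ?_, fun k => ?_, ?_⟩
  · exact (hquot _ ((hr1 k).trans hone_abs)).congr_left fun x => (hr k x).symm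
  -- `K k / H 0` may grow linearly, but the contribution of the dominant mode to the combination is
  -- exactly `k ν^(k-1) ν'`. Only `R` and `T` remain, and the division by `H 0` makes them decay.
  · have h1 := hquot (fun x => T k x - (ν : ℂ) ^ k * T 0 x - k * (ν : ℂ) ^ (k - 1) * ν' * R 0 x)
      (((hT k).sub ((hT 0).const_mul_left _)).sub
        (((hR 0).const_mul_left (k * (ν : ℂ) ^ (k - 1) * ν')).trans hone_abs))
    have h2 := (((hr1 k).mul hinv).mul hσ).trans
      ((hexp.congr_left fun x => by ring : (fun x : ℝ => 1 * Real.exp (-b * |x|) * (1 + |x|)) =O[l]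
        fun x => Real.exp (-(b / 2) * |x|)))
    refine (h1.sub h2).congr_left fun x => ?_
    rw [← hr k x]
    have e : K k x - (ν : ℂ) ^ k * K 0 x - k * (ν : ℂ) ^ (k - 1) * ν' * H 0 x =
        T k x - (ν : ℂ) ^ k * T 0 x - k * (ν : ℂ) ^ (k - 1) * ν' * R 0 x := by
      rw [hK, hK, hH]; unfold expMode expModeDot; simp; ring
    rw [← e]
    field_simp [hH0 x]
    ring
  -- The linearly growing part of `K 0 / H 0` is real, so the imaginary part still converges.
  · have h1 : ExpTendsto l (b / 2)
        (fun x => K 0 x / H 0 x - (ν' * ((x + η : ℝ) : ℂ) + ν * (η' : ℂ))) (A' / A) := by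
      have hX := isBigO_id_one_add_abs l (ν' : ℂ) ν η η'
      have hc : (fun _ : ℝ => A' / A) =O[l] fun x : ℝ => 1 + |x| :=
        (isBigO_const_const _ (one_ne_zero (α := ℝ)) l).trans hone_abs
      have h3 : (fun x : ℝ => T 0 x - (A' / A + (ν' * ((x + η : ℝ) : ℂ) + ν * (η' : ℂ))) * R 0 x)
          =O[l] fun x => 1 + |x| := by
        refine (hT 0).sub (((hc.add hX).mul (hR 0)).congr_right fun x => mul_one _)
      refine (hquot _ h3).congr_left fun x => ?_
      have e : K 0 x - (A' / A + (ν' * ((x + η : ℝ) : ℂ) + ν * (η' : ℂ))) * H 0 x =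
          T 0 x - (A' / A + (ν' * ((x + η : ℝ) : ℂ) + ν * (η' : ℂ))) * R 0 x := by
        rw [hK, hH]; unfold expMode expModeDot; field_simp; simp; ring
      rw [← e]
      field_simp [hH0 x]
      ring
    refine (h1.im.tendsto hl (by positivity)).congr fun x => ?_
    have : (((ν' : ℂ) * ((x + η : ℝ) : ℂ) + ν * (η' : ℂ))).im = 0 := by
      rw [← Complex.ofReal_mul, ← Complex.ofReal_mul, ← Complex.ofReal_add, Complex.ofReal_im]
    rw [Complex.sub_im, this, sub_zero]

/-! ### From bilinear identities to the flow. -/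

theorem HasDerivAt.eq_zero_of_eventually_eq_zero {f : ℝ → ℝ} {f' θ : ℝ} (h : HasDerivAt f f' θ)
    (h0 : ∀ᶠ s in 𝓝 θ, f s = 0) : f' = 0 :=
  h.unique ((hasDerivAt_const θ (0 : ℝ)).congr_of_eventuallyEq h0)

theorem HasDerivAt.complex_re {f : ℝ → ℂ} {f' : ℂ} {x : ℝ} (h : HasDerivAt f f' x) :
    HasDerivAt (fun s => (f s).re) f'.re x :=
  Complex.reCLM.hasFDerivAt.comp_hasDerivAt x h

theorem HasDerivAt.complex_im {f : ℝ → ℂ} {f' : ℂ} {x : ℝ} (h : HasDerivAt f f' x) :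
    HasDerivAt (fun s => (f s).im) f'.im x :=
  Complex.imCLM.hasFDerivAt.comp_hasDerivAt x h

/-- The logarithmic derivatives of a family of functions solving the bilinear identities of the
breather tau function form a breather flow. -/
theorem breatherFlow_of_tau {κ θ dδ dc : ℝ} {δ c : ℝ → ℝ} {H : ℕ → ℝ → ℝ → ℂ}
    {K : ℕ → ℝ → ℂ} {r : ℕ → ℝ → ℝ → ℂ} {ρ : ℕ → ℝ → ℂ}
    (hr : ∀ k s x, r k s x = H k s x / H 0 s x)
    (hρ : ∀ k x, ρ k x = K k x / H 0 θ x - r k θ x * (K 0 x / H 0 θ x))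
    (hH : ∀ k s x, HasDerivAt (H k s) (H (k + 1) s x) x)
    (hK : ∀ k x, HasDerivAt (K k) (K (k + 1) x) x)
    (hHK : ∀ k x, HasDerivAt (fun s => H k s x) (K k x) θ)
    (hδ : HasDerivAt δ dδ θ) (hc : HasDerivAt c dc θ)
    (hH0 : ∀ᶠ s in 𝓝 θ, ∀ x, H 0 s x ≠ 0)
    (h1 : ∀ᶠ s in 𝓝 θ, ∀ x, (r 1 s x).im ^ 2 + (r 1 s x).re ^ 2 + κ * (r 1 s x).im
      - (r 2 s x).re = 0)
    (h2 : ∀ᶠ s in 𝓝 θ, ∀ x, (r 2 s x).im * (r 1 s x).re - (r 2 s x).re * (r 1 s x).im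
      + δ s * (r 1 s x).im - (r 3 s x).im = 0)
    (h3 : ∀ᶠ s in 𝓝 θ, ∀ x, (r 2 s x).re ^ 2 + (r 2 s x).im ^ 2 - c s
      - δ s * ((r 2 s x).re - κ * (r 1 s x).im) + 2 * κ * ((r 2 s x).im * (r 1 s x).re
        - (r 2 s x).re * (r 1 s x).im) = 0) :
    BreatherFlow κ (δ θ) (c θ) dδ dc (fun x => (r 1 θ x).im) (fun x => (r 1 θ x).re)
      (fun x => (r 2 θ x).im) (fun x => (ρ 1 x).im) (fun x => (ρ 1 x).re)
      (fun x => (ρ 2 x).im) ∧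
    (∀ k x, HasDerivAt (fun s => r k s x) (ρ k x) θ) ∧
    ∀ x, HasDerivAt (fun x => (K 0 x / H 0 θ x).im) (ρ 1 x).im x := by
  have h00 := hH0.self_of_nhds
  have hr0 : ∀ x, r 0 θ x = 1 := fun x => by rw [hr, div_self (h00 x)]
  have hrx : ∀ k x, HasDerivAt (r k θ) (r (k + 1) θ x - r k θ x * r 1 θ x) x := by
    intro k x
    have e : r k θ = fun x => H k θ x / H 0 θ x := funext fun x => hr k θ x
    have hd := (hH k θ x).div (hH 0 θ x) (h00 x)
    rw [e]
    refine hd.congr_deriv ?_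
    have := h00 x
    simp only [hr]
    field_simp
  have hsx : ∀ k x, HasDerivAt (fun x => K k x / H 0 θ x)
      (K (k + 1) x / H 0 θ x - K k x / H 0 θ x * r 1 θ x) x := by
    intro k x
    refine ((hK k x).div (hH 0 θ x) (h00 x)).congr_deriv ?_
    have := h00 x
    simp only [hr]
    field_simp
  have hρx : ∀ k x, HasDerivAt (ρ k) (ρ (k + 1) x - r 1 θ x * ρ k x - r k θ x * ρ 1 x) x := by
    intro k x
    have e : ρ k = fun x => K k x / H 0 θ x - r k θ x * (K 0 x / H 0 θ x) :=
      funext fun x => hρ k x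
    have hd := (hsx k x).sub ((hrx k x).mul (hsx 0 x))
    rw [e]
    refine hd.congr_deriv ?_
    simp only [hρ]
    ring
  have hrθ : ∀ k x, HasDerivAt (fun s => r k s x) (ρ k x) θ := by
    intro k x
    have e : (fun s => r k s x) = fun s => H k s x / H 0 s x := funext fun s => hr k s x
    rw [e]
    refine ((hHK k x).div (hHK 0 x) (h00 x)).congr_deriv ?_
    have := h00 x
    simp only [hρ, hr]
    field_simp
  have i1 := h1.self_of_nhds
  have i2 := h2.self_of_nhds
  have i3 := h3.self_of_nhds
  -- The identities hold for all parameters near `θ`, hence can be differentiated there.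
  have j1 : ∀ x, 2 * (r 1 θ x).im * (ρ 1 x).im + 2 * (r 1 θ x).re * (ρ 1 x).re
      + κ * (ρ 1 x).im - (ρ 2 x).re = 0 := by
    intro x
    have p := (hrθ 1 x).complex_im
    have q := (hrθ 1 x).complex_re
    have v := (hrθ 2 x).complex_re
    have := (((p.pow 2).add (q.pow 2)).add (p.const_mul κ)).sub v
    have := this.eq_zero_of_eventually_eq_zero (h1.mono fun s hs => hs x)
    push_cast at this
    linear_combination this
  have j2 : ∀ x, (ρ 2 x).im * (r 1 θ x).re + (r 2 θ x).im * (ρ 1 x).re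
      - (ρ 2 x).re * (r 1 θ x).im - (r 2 θ x).re * (ρ 1 x).im
      + dδ * (r 1 θ x).im + δ θ * (ρ 1 x).im - (ρ 3 x).im = 0 := by
    intro x
    have p := (hrθ 1 x).complex_im
    have q := (hrθ 1 x).complex_re
    have v := (hrθ 2 x).complex_re
    have w := (hrθ 2 x).complex_im
    have := (((w.mul q).sub (v.mul p)).add (hδ.mul p)).sub (hrθ 3 x).complex_im
    have := this.eq_zero_of_eventually_eq_zero (h2.mono fun s hs => hs x)
    linear_combination this
  have j3 : ∀ x, 2 * (r 2 θ x).re * (ρ 2 x).re + 2 * (r 2 θ x).im * (ρ 2 x).im - dc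
      - dδ * ((r 2 θ x).re - κ * (r 1 θ x).im) - δ θ * ((ρ 2 x).re - κ * (ρ 1 x).im)
      + 2 * κ * ((ρ 2 x).im * (r 1 θ x).re + (r 2 θ x).im * (ρ 1 x).re
      - (ρ 2 x).re * (r 1 θ x).im - (r 2 θ x).re * (ρ 1 x).im) = 0 := by
    intro x
    have p := (hrθ 1 x).complex_im
    have q := (hrθ 1 x).complex_re
    have v := (hrθ 2 x).complex_re
    have w := (hrθ 2 x).complex_im
    have := ((((v.pow 2).add (w.pow 2)).sub hc).sub (hδ.mul (v.sub (p.const_mul κ)))).add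
      (((w.mul q).sub (v.mul p)).const_mul (2 * κ))
    have := this.eq_zero_of_eventually_eq_zero (h3.mono fun s hs => hs x)
    simp only [Pi.sub_apply] at this
    push_cast at this
    linear_combination this
  -- From `r_k' = r_(k+1) - r_k r_1` and its linearization, the system closes once the first
  -- identity eliminates `Re r_2` and the second `Im r_3`; the third becomes the first integral.
  refine ⟨⟨fun x => ?_, fun x => ?_, fun x => ?_, fun x => ?_, fun x => ?_, fun x => ?_,
    fun x => ?_, fun x => ?_⟩, hrθ, fun x => ?_⟩
  · refine (hrx 1 x).complex_im.congr_deriv ?_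
    simp only [Complex.sub_im, Complex.mul_im]; ring
  · refine (hrx 1 x).complex_re.congr_deriv ?_
    simp only [Complex.sub_re, Complex.mul_re]; linear_combination -i1 x
  · refine (hrx 2 x).complex_im.congr_deriv ?_
    simp only [Complex.sub_im, Complex.mul_im]
    linear_combination -i2 x + 2 * (r 1 θ x).im * i1 x
  · refine (hρx 1 x).complex_im.congr_deriv ?_
    simp only [Complex.sub_im, Complex.mul_im]; ring
  · refine (hρx 1 x).complex_re.congr_deriv ?_
    simp only [Complex.sub_re, Complex.mul_re]; linear_combination -j1 x
  · refine (hρx 2 x).complex_im.congr_deriv ?_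
    simp only [Complex.sub_im, Complex.mul_im]
    linear_combination -j2 x + 2 * (r 1 θ x).im * j1 x + 2 * (ρ 1 x).im * i1 x
  · have e : (r 1 θ x).im ^ 2 + (r 1 θ x).re ^ 2 + κ * (r 1 θ x).im = (r 2 θ x).re := by
      linear_combination i1 x
    have e' : (r 1 θ x).im ^ 2 + (r 1 θ x).re ^ 2 = (r 2 θ x).re - κ * (r 1 θ x).im := by
      linear_combination i1 x
    rw [e, e']
    exact i3 x
  · have e : (r 1 θ x).im ^ 2 + (r 1 θ x).re ^ 2 + κ * (r 1 θ x).im = (r 2 θ x).re := by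
      linear_combination i1 x
    have e' : (r 1 θ x).im ^ 2 + (r 1 θ x).re ^ 2 = (r 2 θ x).re - κ * (r 1 θ x).im := by
      linear_combination i1 x
    have f : 2 * (r 1 θ x).im * (ρ 1 x).im + 2 * (r 1 θ x).re * (ρ 1 x).re
        + κ * (ρ 1 x).im = (ρ 2 x).re := by linear_combination j1 x
    have f' : 2 * (r 1 θ x).im * (ρ 1 x).im + 2 * (r 1 θ x).re * (ρ 1 x).re
        = (ρ 2 x).re - κ * (ρ 1 x).im := by linear_combination j1 x
    rw [e, e', f, f']
    linear_combination j3 x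
  · refine (hsx 0 x).complex_im.congr_deriv ?_
    rw [hρ, hr 1, mul_comm (H 1 θ x / H 0 θ x)]

/-! ### The tau function of the Gardner breather. -/

/-- The scalar `1 / (α √(α² + β²) √Δ)`. -/
def tauScale (α β μ : ℝ) : ℝ := (α * √(α ^ 2 + β ^ 2) * √(gardnerDelta α β μ))⁻¹

/-- The coefficient of the growing exponential in `F + i G`. -/
def tauA (α β μ : ℝ) : ℂ :=
  1 / 2 - (β : ℂ) * (((√2 * μ : ℝ) : ℂ) * Complex.I) / ((gardnerDelta α β μ : ℝ) : ℂ)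

/-- The coefficient of `exp (i α y₁)` in `F + i G`. -/
def tauP (α β μ : ℝ) : ℂ :=
  (β : ℂ) * (tauScale α β μ : ℂ) / 2 * ((β : ℂ) ^ 2 - (α * Complex.I) ^ 2
    + ((√2 * μ : ℝ) : ℂ) * Complex.I * (α * Complex.I) - ((√2 * μ : ℝ) : ℂ) * Complex.I * β)

/-- The coefficient of `exp (-i α y₁)` in `F + i G`. -/
def tauM (α β μ : ℝ) : ℂ :=
  (β : ℂ) * (tauScale α β μ : ℂ) / 2 * (((√2 * μ : ℝ) : ℂ) * Complex.I * (α * Complex.I)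
    + ((√2 * μ : ℝ) : ℂ) * Complex.I * β - (β : ℂ) ^ 2 + (α * Complex.I) ^ 2)

/-- The shift of `y₁`. -/
def tauShift₁ (α β t x₁ : ℝ) : ℝ := (α ^ 2 - 3 * β ^ 2) * t + x₁

/-- The shift of `y₂`. -/
def tauShift₂ (α β t x₂ : ℝ) : ℝ := (3 * α ^ 2 - β ^ 2) * t + x₂

/-- The `k`-th `x`-derivative of `F + i G`. -/
def gardnerTau (α β μ t x₁ x₂ : ℝ) (k : ℕ) (x : ℝ) : ℂ :=
  expMode (tauA α β μ) (β : ℂ) (tauShift₂ α β t x₂) k x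
    + expMode (1 / 2) (-(β : ℂ)) (tauShift₂ α β t x₂) k x
    + expMode (tauP α β μ) (α * Complex.I) (tauShift₁ α β t x₁) k x
    + expMode (tauM α β μ) (-(α * Complex.I)) (tauShift₁ α β t x₁) k x

theorem hasDerivAt_gardnerTau (α β μ t x₁ x₂ : ℝ) (k : ℕ) (x : ℝ) :
    HasDerivAt (gardnerTau α β μ t x₁ x₂ k) (gardnerTau α β μ t x₁ x₂ (k + 1) x) x :=
  (((hasDerivAt_expMode _ _ _ k x).add (hasDerivAt_expMode _ _ _ k x)).add
    (hasDerivAt_expMode _ _ _ k x)).add (hasDerivAt_expMode _ _ _ k x)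

section

variable {α β μ : ℝ} (t x₁ x₂ : ℝ)

/-- As `cosh + sinh = exp`, `G` contributes to the growing real exponential only, so the decaying
one keeps the constant coefficient `1/2` from `F`. -/
theorem gardnerTau_zero (hα : 0 < α) (hΔ : 0 < gardnerDelta α β μ) (x : ℝ) :
    gardnerTau α β μ t x₁ x₂ 0 x =
      (gardnerF α β μ t x₁ x₂ x : ℂ) + (gardnerG α β μ t x₁ x₂ x : ℂ) * Complex.I := by
  have hn : 0 < α ^ 2 + β ^ 2 := by positivity
  have hn2 : √(α ^ 2 + β ^ 2) ^ 2 = α ^ 2 + β ^ 2 := Real.sq_sqrt hn.le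
  have hn0 : √(α ^ 2 + β ^ 2) ≠ 0 := (Real.sqrt_pos.2 hn).ne'
  have hd0 : √(gardnerDelta α β μ) ≠ 0 := (Real.sqrt_pos.2 hΔ).ne'
  have hD0 := hΔ.ne'
  have hα0 := hα.ne'
  have y1 : gardnerY₁ α β t x₁ x = x + tauShift₁ α β t x₁ := by
    unfold gardnerY₁ tauShift₁; ring
  have y2 : gardnerY₂ α β t x₂ x = x + tauShift₂ α β t x₂ := by
    unfold gardnerY₂ tauShift₂; ring
  unfold gardnerTau expMode gardnerF gardnerG
  rw [y1, y2]
  simp only [pow_zero, mul_one]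
  have eE : Complex.exp ((β : ℂ) * ((x + tauShift₂ α β t x₂ : ℝ) : ℂ)) =
      ((Real.exp (β * (x + tauShift₂ α β t x₂)) : ℝ) : ℂ) := by push_cast; rfl
  have eE' : Complex.exp (-(β : ℂ) * ((x + tauShift₂ α β t x₂ : ℝ) : ℂ)) =
      ((Real.exp (-(β * (x + tauShift₂ α β t x₂))) : ℝ) : ℂ) := by push_cast; congr 1; ring
  have eU : Complex.exp ((α : ℂ) * Complex.I * ((x + tauShift₁ α β t x₁ : ℝ) : ℂ)) =
      ((Real.cos (α * (x + tauShift₁ α β t x₁)) : ℝ) : ℂ)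
        + ((Real.sin (α * (x + tauShift₁ α β t x₁)) : ℝ) : ℂ) * Complex.I := by
    rw [show (α : ℂ) * Complex.I * ((x + tauShift₁ α β t x₁ : ℝ) : ℂ) =
      ((α * (x + tauShift₁ α β t x₁) : ℝ) : ℂ) * Complex.I by push_cast; ring,
      Complex.exp_mul_I, Complex.ofReal_cos, Complex.ofReal_sin]
  have eU' : Complex.exp (-((α : ℂ) * Complex.I) * ((x + tauShift₁ α β t x₁ : ℝ) : ℂ)) =
      ((Real.cos (α * (x + tauShift₁ α β t x₁)) : ℝ) : ℂ)
        - ((Real.sin (α * (x + tauShift₁ α β t x₁)) : ℝ) : ℂ) * Complex.I := by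
    rw [show -((α : ℂ) * Complex.I) * ((x + tauShift₁ α β t x₁ : ℝ) : ℂ) =
      ((-(α * (x + tauShift₁ α β t x₁)) : ℝ) : ℂ) * Complex.I by push_cast; ring,
      Complex.exp_mul_I, ← Complex.ofReal_cos, ← Complex.ofReal_sin, Real.cos_neg, Real.sin_neg]
    push_cast; ring
  rw [eE, eE', eU, eU', Real.cosh_add_sinh, Real.cosh_eq]
  generalize Real.exp (β * (x + tauShift₂ α β t x₂)) = E
  generalize Real.exp (-(β * (x + tauShift₂ α β t x₂))) = E'
  generalize Real.cos (α * (x + tauShift₁ α β t x₁)) = C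
  generalize Real.sin (α * (x + tauShift₁ α β t x₁)) = S
  unfold tauA tauP tauM tauScale
  generalize gardnerDelta α β μ = D at *
  generalize √(α ^ 2 + β ^ 2) = n at *
  generalize √D = d at *
  have hα' : (α : ℂ) ≠ 0 := by exact_mod_cast hα0
  have hn' : (n : ℂ) ≠ 0 := by exact_mod_cast hn0
  have hd' : (d : ℂ) ≠ 0 := by exact_mod_cast hd0
  have hD' : (D : ℂ) ≠ 0 := by exact_mod_cast hD0
  have hn2' : (n : ℂ) ^ 2 = α ^ 2 + β ^ 2 := by exact_mod_cast hn2
  have hI := Complex.I_sq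
  have hI3 : Complex.I ^ 3 = -Complex.I := by rw [pow_succ, hI]; ring
  push_cast
  field_simp
  ring_nf
  simp only [hI, hI3, hn2']
  ring

/-- If both vanish, eliminating the sine turns `F = 0` into `w² + 1/2 + E²/2 = wC` with `C` the
cosine and `E > 0`. Completing the square gives `1/2 + E²/2 ≤ C²/4 ≤ 1/4`, which is absurd. -/
theorem gardnerF_ne_zero_or_gardnerG_ne_zero {α β μ t x₁ x₂ x : ℝ} (hα : 0 < α) (hΔ : 0 < gardnerDelta α β μ) :
    gardnerF α β μ t x₁ x₂ x ≠ 0 ∨ gardnerG α β μ t x₁ x₂ x ≠ 0 := by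
  by_contra hcon
  push Not at hcon
  obtain ⟨hF, hG⟩ := hcon
  have hn : 0 < α ^ 2 + β ^ 2 := by positivity
  have hn0 : √(α ^ 2 + β ^ 2) ≠ 0 := (Real.sqrt_pos.2 hn).ne'
  have hd0 : √(gardnerDelta α β μ) ≠ 0 := (Real.sqrt_pos.2 hΔ).ne'
  have hd2 : √(gardnerDelta α β μ) ^ 2 = gardnerDelta α β μ := Real.sq_sqrt hΔ.le
  have hα0 := hα.ne'
  unfold gardnerF at hF
  unfold gardnerG at hG
  rw [Real.cosh_add_sinh] at hG
  rw [Real.cosh_eq, Real.exp_neg] at hF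
  have hE := Real.exp_pos (β * gardnerY₂ α β t x₂ x)
  have hcs := Real.sin_sq_add_cos_sq (α * gardnerY₁ α β t x₁ x)
  generalize Real.exp (β * gardnerY₂ α β t x₂ x) = E at *
  generalize Real.sin (α * gardnerY₁ α β t x₁ x) = S at *
  generalize Real.cos (α * gardnerY₁ α β t x₁ x) = C at *
  generalize √(α ^ 2 + β ^ 2) = n at *
  generalize √(gardnerDelta α β μ) = d at *
  rw [← hd2] at hG
  generalize √2 * μ = κ at *
  have hE0 := hE.ne'
  rw [sub_eq_zero] at hF hG
  field_simp at hF hG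
  -- `w` is the quantity in which the vanishing of `F` becomes a sum of squares.
  have hw : (κ * β * E / (n * d)) ^ 2 + 1 / 2 + E ^ 2 / 2 = κ * β * E / (n * d) * C := by
    by_cases hβ : β = 0
    · subst hβ
      simp [hα0, hn0, hd0] at hF
      nlinarith
    have hS : n * d * S = κ * α * E := by
      have : β * (n * d * S - κ * α * E) = 0 := by
        linear_combination hG
      rcases mul_eq_zero.1 this with h | h
      · exact absurd h hβ
      · linarith
    have hF' : α * n * d * (E ^ 2 + 1) = 2 * E * κ * β * (α * C - β * S) := by
      linear_combination hF
    field_simp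
    have : α * ((κ * β * E) ^ 2 * 2 + (n * d) ^ 2 * (1 + E ^ 2)
        - 2 * κ * β * E * C * (n * d)) = 0 := by
      linear_combination n * d * hF' - 2 * E * κ * β ^ 2 * hS
    rcases mul_eq_zero.1 this with h | h
    · exact absurd h hα0
    · linear_combination h
  nlinarith [sq_nonneg (κ * β * E / (n * d) - C / 2), sq_nonneg S, sq_nonneg E]

end

section

variable {α β μ : ℝ} (t x₁ x₂ : ℝ)

theorem gardnerTau_zero_ne (hα : 0 < α) (hΔ : 0 < gardnerDelta α β μ) (x : ℝ) :
    gardnerTau α β μ t x₁ x₂ 0 x ≠ 0 := by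
  intro h
  rw [gardnerTau_zero t x₁ x₂ hα hΔ, Complex.ext_iff] at h
  simp at h
  rcases gardnerF_ne_zero_or_gardnerG_ne_zero (t := t) (x₁ := x₁) (x₂ := x₂) (x := x) hα hΔ
    with h' | h'
  · exact h' h.1
  · exact h' h.2

theorem gardnerBreather_eq_im (hα : 0 < α) (hΔ : 0 < gardnerDelta α β μ) (x : ℝ) :
    gardnerBreather α β μ t x₁ x₂ x =
      2 * √2 * (gardnerTau α β μ t x₁ x₂ 1 x / gardnerTau α β μ t x₁ x₂ 0 x).im := by
  have hd := hasDerivAt_gardnerTau α β μ t x₁ x₂ 0 x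
  have h0 := gardnerTau_zero t x₁ x₂ hα hΔ (β := β)
  have hF : gardnerF α β μ t x₁ x₂ = fun x => (gardnerTau α β μ t x₁ x₂ 0 x).re := by
    funext x; rw [h0]; simp
  have hG : gardnerG α β μ t x₁ x₂ = fun x => (gardnerTau α β μ t x₁ x₂ 0 x).im := by
    funext x; rw [h0]; simp
  have hF' : deriv (gardnerF α β μ t x₁ x₂) x = (gardnerTau α β μ t x₁ x₂ 1 x).re := by
    rw [hF]; exact hd.complex_re.deriv
  have hG' : deriv (gardnerG α β μ t x₁ x₂) x = (gardnerTau α β μ t x₁ x₂ 1 x).im := by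
    rw [hG]; exact hd.complex_im.deriv
  rw [gardnerBreather, hF', hG', hF, hG, Complex.div_im, Complex.normSq_apply]
  simp only [← sub_div, ← pow_two]
  ring

/-- These are the bilinear identities divided by `|H|²`: the real part of the first and third, the
imaginary part of the second. -/
theorem gardnerTau_relations (hα : 0 < α) (hΔ : 0 < gardnerDelta α β μ) (x : ℝ)
    {r : ℕ → ℂ} (hr : ∀ k, r k = gardnerTau α β μ t x₁ x₂ k x / gardnerTau α β μ t x₁ x₂ 0 x) :
    ((r 1).im ^ 2 + (r 1).re ^ 2 + √2 * μ * (r 1).im - (r 2).re = 0) ∧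
    ((r 2).im * (r 1).re - (r 2).re * (r 1).im + (β ^ 2 - α ^ 2) * (r 1).im - (r 3).im = 0) ∧
    ((r 2).re ^ 2 + (r 2).im ^ 2 - α ^ 2 * β ^ 2
      - (β ^ 2 - α ^ 2) * ((r 2).re - √2 * μ * (r 1).im) + 2 * (√2 * μ) * ((r 2).im * (r 1).re
        - (r 2).re * (r 1).im) = 0) := by
  have hT0 := gardnerTau_zero_ne t x₁ x₂ hα hΔ x
  set κ : ℝ := √2 * μ with hκ
  have hκ2 : κ ^ 2 = 2 * μ ^ 2 := by rw [hκ, mul_pow, Real.sq_sqrt (by norm_num)]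
  have hD : gardnerDelta α β μ = β ^ 2 - κ ^ 2 + α ^ 2 := by rw [gardnerDelta, hκ2]; ring
  set a : ℂ := α * Complex.I with ha
  set k : ℂ := (κ : ℂ) * Complex.I with hk
  have ha2 : a ^ 2 = -(α : ℂ) ^ 2 := by rw [ha, mul_pow, Complex.I_sq]; ring
  have hk2 : k ^ 2 = -(κ : ℂ) ^ 2 := by rw [hk, mul_pow, Complex.I_sq]; ring
  have hDc : ((gardnerDelta α β μ : ℝ) : ℂ) = (β : ℂ) ^ 2 + k ^ 2 - a ^ 2 := by
    rw [hD, ha2, hk2]; push_cast; ring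
  have hD0 : ((gardnerDelta α β μ : ℝ) : ℂ) ≠ 0 := by exact_mod_cast hΔ.ne'
  have hn : 0 < α ^ 2 + β ^ 2 := by positivity
  -- `tauScale` is the normalization under which the constant mode cancels.
  have hG : -(tauScale α β μ : ℂ) ^ 2 * a ^ 2 * ((β : ℂ) ^ 2 - a ^ 2)
      * ((gardnerDelta α β μ : ℝ) : ℂ) = 1 := by
    rw [ha2]
    have : tauScale α β μ ^ 2 * α ^ 2 * (β ^ 2 + α ^ 2) * gardnerDelta α β μ = 1 := by
      rw [tauScale, inv_pow, mul_pow, mul_pow, Real.sq_sqrt hn.le, Real.sq_sqrt hΔ.le]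
      have := hα.ne'
      have := hΔ.ne'
      have := hn.ne'
      field_simp
      ring
    have := congrArg (fun y : ℝ => (y : ℂ)) this
    push_cast at this
    linear_combination this
  set E : ℂ := Complex.exp ((β : ℂ) * ((x + tauShift₂ α β t x₂ : ℝ) : ℂ)) with hE
  set E' : ℂ := Complex.exp (-(β : ℂ) * ((x + tauShift₂ α β t x₂ : ℝ) : ℂ)) with hE'
  set U : ℂ := Complex.exp (a * ((x + tauShift₁ α β t x₁ : ℝ) : ℂ)) with hU
  set U' : ℂ := Complex.exp (-a * ((x + tauShift₁ α β t x₁ : ℝ) : ℂ)) with hU'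
  have hEE : E * E' = 1 := by rw [hE, hE', ← Complex.exp_add]; simp
  have hUU : U * U' = 1 := by rw [hU, hU', ← Complex.exp_add]; simp
  have ca : (starRingEnd ℂ) a = -a := by simp [ha]
  have ck : (starRingEnd ℂ) k = -k := by simp [hk]
  have cE : (starRingEnd ℂ) E = E := by
    rw [hE, ← Complex.exp_conj, map_mul, Complex.conj_ofReal, Complex.conj_ofReal]
  have cE' : (starRingEnd ℂ) E' = E' := by
    rw [hE', ← Complex.exp_conj, map_mul, map_neg, Complex.conj_ofReal, Complex.conj_ofReal]
  have cU : (starRingEnd ℂ) U = U' := by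
    rw [hU, hU', ← Complex.exp_conj, map_mul, ca, Complex.conj_ofReal]
  have cU' : (starRingEnd ℂ) U' = U := by
    rw [hU, hU', ← Complex.exp_conj, map_mul, map_neg, ca, Complex.conj_ofReal, neg_neg]
  have hH : (fun j => gardnerTau α β μ t x₁ x₂ j x) =
      tauSum (1 / 2 - β * k / (gardnerDelta α β μ : ℝ)) (1 / 2)
        (β * tauScale α β μ / 2 * ((β : ℂ) ^ 2 - a ^ 2 + k * a - k * β))
        (β * tauScale α β μ / 2 * (k * a + k * β - (β : ℂ) ^ 2 + a ^ 2)) a β E E' U U' := by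
    funext j; rfl
  -- Conjugation changes the signs of `a` and `k` and exchanges `U` with `U'`.
  have hK : (fun j => (starRingEnd ℂ) (gardnerTau α β μ t x₁ x₂ j x)) =
      tauSum (1 / 2 + β * k / (gardnerDelta α β μ : ℝ)) (1 / 2)
        (β * tauScale α β μ / 2 * ((β : ℂ) ^ 2 - a ^ 2 + k * a + k * β))
        (β * tauScale α β μ / 2 * (k * a - k * β - (β : ℂ) ^ 2 + a ^ 2)) (-a) β E E' U' U := by
    funext j
    rw [congrFun hH j]
    unfold tauSum
    simp only [map_add, map_sub, map_mul, map_div₀, map_pow, map_neg, map_one, map_ofNat,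
      Complex.conj_ofReal, ca, ck, cE, cE', cU, cU']
    ring
  obtain ⟨h1, h2, h3⟩ := tau_bilinear hDc hD0 hEE hUU hG hH hK
  have hc0 : (starRingEnd ℂ) (gardnerTau α β μ t x₁ x₂ 0 x) ≠ 0 := by simpa using hT0
  have eH : ∀ j, gardnerTau α β μ t x₁ x₂ j x = r j * gardnerTau α β μ t x₁ x₂ 0 x :=
    fun j => by rw [hr]; field_simp
  have eK : ∀ j, (starRingEnd ℂ) (gardnerTau α β μ t x₁ x₂ j x) =
      (starRingEnd ℂ) (r j) * (starRingEnd ℂ) (gardnerTau α β μ t x₁ x₂ 0 x) :=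
    fun j => by rw [← map_mul, ← eH]
  have r0 : r 0 = 1 := by rw [hr, div_self hT0]
  simp only [eK 1, eK 2, eK 3] at h1 h2 h3
  simp only [eH 1, eH 2, eH 3] at h1 h2 h3
  generalize gardnerTau α β μ t x₁ x₂ 0 x = T at *
  generalize (starRingEnd ℂ) T = T' at *
  have g1 : r 2 + (starRingEnd ℂ) (r 2) - 2 * (r 1 * (starRingEnd ℂ) (r 1))
      + k * (r 1 - (starRingEnd ℂ) (r 1)) = 0 := by
    refine (mul_eq_zero.1 ?_).resolve_right (mul_ne_zero hT0 hc0)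
    linear_combination h1
  have g2 : r 3 - (starRingEnd ℂ) (r 3) - ((β : ℂ) ^ 2 + a ^ 2) * (r 1 - (starRingEnd ℂ) (r 1))
      - (r 2 * (starRingEnd ℂ) (r 1) - r 1 * (starRingEnd ℂ) (r 2)) = 0 := by
    refine (mul_eq_zero.1 ?_).resolve_right (mul_ne_zero hT0 hc0)
    linear_combination h2
  have g3 : 2 * (r 2 * (starRingEnd ℂ) (r 2)) + 2 * a ^ 2 * (β : ℂ) ^ 2
      - ((β : ℂ) ^ 2 + a ^ 2) * ((r 2 + (starRingEnd ℂ) (r 2))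
        + k * (r 1 - (starRingEnd ℂ) (r 1)))
      - 2 * k * (r 2 * (starRingEnd ℂ) (r 1) - r 1 * (starRingEnd ℂ) (r 2)) = 0 := by
    refine (mul_eq_zero.1 ?_).resolve_right (mul_ne_zero hT0 hc0)
    linear_combination h3
  rw [ha2] at g2 g3
  rw [hk] at g1 g3
  have g1' := congrArg Complex.re g1
  have g2' := congrArg Complex.im g2
  have g3' := congrArg Complex.re g3
  simp [← Complex.ofReal_pow] at g1' g2' g3'
  refine ⟨?_, ?_, ?_⟩
  · linear_combination (-1 / 2) * g1'
  · linear_combination (-1 / 2) * g2'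
  · linear_combination (1 / 2) * g3'

end

/-! ### Variation of the breather along a curve of parameters. -/

theorem breatherAsymptotics_of_expTendsto {l : Filter ℝ} {r ν ν' : ℝ} {R ρ : ℕ → ℝ → ℂ}
    (hR : ∀ k, ExpTendsto l r (R k) ((ν : ℂ) ^ k))
    (hρ : ∀ k, ExpTendsto l r (ρ k) (k * (ν : ℂ) ^ (k - 1) * ν')) :
    BreatherAsymptotics l r ν ν' (fun x => (R 1 x).im) (fun x => (R 1 x).re)
      (fun x => (R 2 x).im) (fun x => (ρ 1 x).im) (fun x => (ρ 1 x).re)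
      (fun x => (ρ 2 x).im) where
  p := (hR 1).im.congr (fun _ => rfl) (by simp)
  q := (hR 1).re.congr (fun _ => rfl) (by simp)
  w := (hR 2).im.congr (fun _ => rfl) (by rw [← Complex.ofReal_pow, Complex.ofReal_im])
  dp := (hρ 1).im.congr (fun _ => rfl) (by simp)
  dq := (hρ 1).re.congr (fun _ => rfl) (by simp)
  dw := (hρ 2).im.congr (fun _ => rfl) (by simp)

section

variable {a b : ℝ → ℝ} {θ a' b' μ : ℝ}

theorem hasDerivAt_gardnerDelta (ha : HasDerivAt a a' θ) (hb : HasDerivAt b b' θ) :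
    HasDerivAt (fun s => gardnerDelta (a s) (b s) μ) (2 * a θ * a' + 2 * b θ * b') θ := by
  unfold gardnerDelta
  refine (((ha.pow 2).add (hb.pow 2)).sub_const (2 * μ ^ 2)).congr_deriv ?_
  push_cast; ring

theorem hasDerivAt_tauA (ha : HasDerivAt a a' θ) (hb : HasDerivAt b b' θ)
    (hΔ : 0 < gardnerDelta (a θ) (b θ) μ) :
    HasDerivAt (fun s => tauA (a s) (b s) μ)
      (-((((√2 * μ * ((b' * gardnerDelta (a θ) (b θ) μ
        - b θ * (2 * a θ * a' + 2 * b θ * b')) / gardnerDelta (a θ) (b θ) μ ^ 2) : ℝ) : ℂ)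
        * Complex.I))) θ := by
  have h := ((hb.div (hasDerivAt_gardnerDelta (μ := μ) ha hb) hΔ.ne').const_mul
    (√2 * μ)).ofReal_comp.mul_const Complex.I |>.const_sub (1 / 2 : ℂ)
  have e : (fun s => tauA (a s) (b s) μ) = fun s => (1 / 2 : ℂ) -
      ((√2 * μ * (b s / gardnerDelta (a s) (b s) μ) : ℝ) : ℂ) * Complex.I := by
    funext s
    unfold tauA
    push_cast
    ring
  rw [e]
  exact h

theorem differentiableAt_tauP_tauM (ha : HasDerivAt a a' θ) (hb : HasDerivAt b b' θ)
    (hα : 0 < a θ) (hΔ : 0 < gardnerDelta (a θ) (b θ) μ) :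
    DifferentiableAt ℝ (fun s => tauP (a s) (b s) μ) θ ∧
      DifferentiableAt ℝ (fun s => tauM (a s) (b s) μ) θ := by
  have hn : 0 < a θ ^ 2 + b θ ^ 2 := by positivity
  have h1 := ((ha.mul (((ha.pow 2).add (hb.pow 2)).sqrt hn.ne')).mul
    ((hasDerivAt_gardnerDelta (μ := μ) ha hb).sqrt hΔ.ne')).inv
      (mul_ne_zero (mul_ne_zero hα.ne' (Real.sqrt_pos.2 hn).ne') (Real.sqrt_pos.2 hΔ).ne')
  have hs : DifferentiableAt ℝ (fun s => ((tauScale (a s) (b s) μ : ℝ) : ℂ)) θ :=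
    h1.ofReal_comp.differentiableAt
  have ha' : DifferentiableAt ℝ (fun s => ((a s : ℝ) : ℂ)) θ := ha.ofReal_comp.differentiableAt
  have hb' : DifferentiableAt ℝ (fun s => ((b s : ℝ) : ℂ)) θ := hb.ofReal_comp.differentiableAt
  unfold tauP tauM
  constructor <;> fun_prop

variable (t x₁ x₂ : ℝ)

/-- The properties of the derivative of the Gardner breather along a curve of parameters. -/
theorem gardner_scaling (ha : HasDerivAt a a' θ) (hb : HasDerivAt b b' θ) (hα : 0 < a θ)
    (hβ : 0 < b θ) (hΔ : 0 < gardnerDelta (a θ) (b θ) μ) {z : ℝ → ℝ}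
    (hz : z = fun x => deriv (fun s => gardnerBreather (a s) (b s) μ t x₁ x₂ x) θ) {M : ℝ}
    (hM : M = 4 * b' + 8 * μ ^ 2 * (b' * gardnerDelta (a θ) (b θ) μ
      - b θ * (2 * a θ * a' + 2 * b θ * b'))
      / (gardnerDelta (a θ) (b θ) μ ^ 2 + 8 * μ ^ 2 * b θ ^ 2)) :
    (∀ x, DifferentiableAt ℝ (fun s => gardnerBreather (a s) (b s) μ t x₁ x₂ x) θ) ∧
    ContDiff ℝ ∞ z ∧
    Integrable (fun x => z x * gardnerL (a θ) (b θ) μ t x₁ x₂ z x) ∧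
    (∫ x, z x * gardnerL (a θ) (b θ) μ t x₁ x₂ z x) =
      -4 * (b θ * b' - a θ * a') * (4 * b' * (a θ ^ 2 - b θ ^ 2) + 8 * a θ * a' * b θ
        + 2 * μ ^ 2 * M) - 4 * (a θ ^ 2 + b θ ^ 2) * (a θ * a' + b θ * b') * M ∧
    gardnerQ (a θ) (b θ) μ t x₁ x₂ z = (∫ x, z x * gardnerL (a θ) (b θ) μ t x₁ x₂ z x) ∧
    MemH2 z := by
  have cα : ∀ᶠ s in 𝓝 θ, 0 < a s := ha.continuousAt.eventually (lt_mem_nhds hα)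
  have cΔ : ∀ᶠ s in 𝓝 θ, 0 < gardnerDelta (a s) (b s) μ :=
    (hasDerivAt_gardnerDelta (μ := μ) ha hb).continuousAt.eventually (lt_mem_nhds hΔ)
  have hA := hasDerivAt_tauA ha hb hΔ
  obtain ⟨hP, hMd⟩ := differentiableAt_tauP_tauM ha hb hα hΔ
  have hη₁ : DifferentiableAt ℝ (fun s => tauShift₁ (a s) (b s) t x₁) θ := by
    have := ha.differentiableAt
    have := hb.differentiableAt
    unfold tauShift₁
    fun_prop
  have hη₂ : DifferentiableAt ℝ (fun s => tauShift₂ (a s) (b s) t x₂) θ := by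
    have := ha.differentiableAt
    have := hb.differentiableAt
    unfold tauShift₂
    fun_prop
  set A' := -((((√2 * μ * ((b' * gardnerDelta (a θ) (b θ) μ
        - b θ * (2 * a θ * a' + 2 * b θ * b')) / gardnerDelta (a θ) (b θ) μ ^ 2) : ℝ) : ℂ)
        * Complex.I)) with hA'
  -- No formula is needed for these derivatives: the oscillating modes enter only the remainders at
  -- both ends, and the derivatives of the real shifts drop out of imaginary parts.
  set P' := deriv (fun s => tauP (a s) (b s) μ) θ
  set M' := deriv (fun s => tauM (a s) (b s) μ) θ
  set η₁ := tauShift₁ (a θ) (b θ) t x₁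
  set η₂ := tauShift₂ (a θ) (b θ) t x₂
  set η₁' := deriv (fun s => tauShift₁ (a s) (b s) t x₁) θ
  set η₂' := deriv (fun s => tauShift₂ (a s) (b s) t x₂) θ
  have hbc : HasDerivAt (fun s => ((b s : ℝ) : ℂ)) (b' : ℂ) θ := hb.ofReal_comp
  have hac : HasDerivAt (fun s => ((a s : ℝ) : ℂ) * Complex.I) ((a' : ℂ) * Complex.I) θ :=
    ha.ofReal_comp.mul_const _
  let H : ℕ → ℝ → ℝ → ℂ := fun k s x => gardnerTau (a s) (b s) μ t x₁ x₂ k x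
  let K₁ : ℕ → ℝ → ℂ := expModeDot (tauA (a θ) (b θ) μ) (b θ) A' b' η₂ η₂'
  let K₂ : ℕ → ℝ → ℂ := expModeDot (1 / 2) (-(b θ : ℂ)) 0 (-(b' : ℂ)) η₂ η₂'
  let K₃ : ℕ → ℝ → ℂ :=
    expModeDot (tauP (a θ) (b θ) μ) (a θ * Complex.I) P' (a' * Complex.I) η₁ η₁'
  let K₄ : ℕ → ℝ → ℂ :=
    expModeDot (tauM (a θ) (b θ) μ) (-(a θ * Complex.I)) M' (-(a' * Complex.I)) η₁ η₁'
  let K : ℕ → ℝ → ℂ := fun k x => K₁ k x + K₂ k x + K₃ k x + K₄ k x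
  let r : ℕ → ℝ → ℝ → ℂ := fun k s x => H k s x / H 0 s x
  let ρ : ℕ → ℝ → ℂ := fun k x => K k x / H 0 θ x - r k θ x * (K 0 x / H 0 θ x)
  have hH : ∀ k s x, HasDerivAt (H k s) (H (k + 1) s x) x :=
    fun k s x => hasDerivAt_gardnerTau _ _ _ _ _ _ k x
  have hK : ∀ k x, HasDerivAt (K k) (K (k + 1) x) x := fun k x =>
    (((hasDerivAt_expModeDot _ _ _ _ _ _ k x).add (hasDerivAt_expModeDot _ _ _ _ _ _ k x)).add
      (hasDerivAt_expModeDot _ _ _ _ _ _ k x)).add (hasDerivAt_expModeDot _ _ _ _ _ _ k x)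
  have hHK : ∀ k x, HasDerivAt (fun s => H k s x) (K k x) θ := fun k x =>
    (((hasDerivAt_expMode_param hA hbc hη₂.hasDerivAt k x).add
      (hasDerivAt_expMode_param (hasDerivAt_const θ (1 / 2 : ℂ)) hbc.neg hη₂.hasDerivAt k x)).add
      (hasDerivAt_expMode_param hP.hasDerivAt hac hη₁.hasDerivAt k x)).add
      (hasDerivAt_expMode_param hMd.hasDerivAt hac.neg hη₁.hasDerivAt k x)
  have hδ : HasDerivAt (fun s => b s ^ 2 - a s ^ 2) (2 * b θ * b' - 2 * a θ * a') θ := by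
    refine ((hb.pow 2).sub (ha.pow 2)).congr_deriv ?_
    push_cast; ring
  have hc : HasDerivAt (fun s => a s ^ 2 * b s ^ 2)
      (2 * a θ * a' * b θ ^ 2 + a θ ^ 2 * (2 * b θ * b')) θ := by
    refine ((ha.pow 2).mul (hb.pow 2)).congr_deriv ?_
    simp only [Pi.pow_apply]
    push_cast; ring
  have hH0 : ∀ᶠ s in 𝓝 θ, ∀ x, H 0 s x ≠ 0 := by
    filter_upwards [cα, cΔ] with s h1 h2 x using gardnerTau_zero_ne t x₁ x₂ h1 h2 x
  obtain ⟨flow, hrθ, hS⟩ := breatherFlow_of_tau (κ := √2 * μ) (H := H) (K := K) (r := r) (ρ := ρ)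
    (fun _ _ _ => rfl) (fun _ _ => rfl) hH hK hHK hδ hc hH0
    (by
      filter_upwards [cα, cΔ] with s h1 h2 x
      exact (gardnerTau_relations t x₁ x₂ h1 h2 x (r := fun k => r k s x) fun k => rfl).1)
    (by
      filter_upwards [cα, cΔ] with s h1 h2 x
      exact (gardnerTau_relations t x₁ x₂ h1 h2 x (r := fun k => r k s x) fun k => rfl).2.1)
    (by
      filter_upwards [cα, cΔ] with s h1 h2 x
      exact (gardnerTau_relations t x₁ x₂ h1 h2 x (r := fun k => r k s x) fun k => rfl).2.2)
  have hBs : ∀ᶠ s in 𝓝 θ, ∀ x, gardnerBreather (a s) (b s) μ t x₁ x₂ x =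
      2 * √2 * (r 1 s x).im := by
    filter_upwards [cα, cΔ] with s h1 h2 x using gardnerBreather_eq_im t x₁ x₂ h1 h2 x
  have hzd : ∀ x, HasDerivAt (fun s => gardnerBreather (a s) (b s) μ t x₁ x₂ x)
      (2 * √2 * (ρ 1 x).im) θ := fun x =>
    ((hrθ 1 x).complex_im.const_mul (2 * √2)).congr_of_eventuallyEq (hBs.mono fun s h => h x)
  have hze : z = fun x => 2 * √2 * (ρ 1 x).im := by
    rw [hz]; exact funext fun x => (hzd x).deriv
  have hB : gardnerBreather (a θ) (b θ) μ t x₁ x₂ = fun x => 2 * √2 * (r 1 θ x).im :=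
    funext hBs.self_of_nhds
  have hκ2 : (√2 * μ) ^ 2 = 2 * μ ^ 2 := by rw [mul_pow, Real.sq_sqrt (by norm_num)]
  set κ := √2 * μ with hκ
  set D := gardnerDelta (a θ) (b θ) μ with hD
  have hAform : tauA (a θ) (b θ) μ = ((1 / 2 : ℝ) : ℂ) - ((κ * b θ / D : ℝ) : ℂ) * Complex.I := by
    unfold tauA
    rw [← hκ, ← hD]
    push_cast
    ring
  have hAne : tauA (a θ) (b θ) μ ≠ 0 := by
    intro h0
    have := congrArg Complex.re h0
    rw [hAform] at this
    simp at this
  have hH0θ := hH0.self_of_nhds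
  -- At `+∞` the mode with exponent `β` dominates; the exponents `±iα` have real part zero, so their
  -- modes stay bounded.
  have top := expTendsto_of_dominant_mode (l := atTop) (b := b θ) (ν := b θ) hβ tendsto_abs_atTop_atTop
    (by filter_upwards [eventually_ge_atTop 0] with x hx; rw [abs_of_nonneg hx])
    hAne (A' := A') (ν' := b') (η := η₂) (η' := η₂') (H := fun k => H k θ) (K := K)
    (R := fun k x => expMode (1 / 2) (-(b θ : ℂ)) η₂ k x
      + expMode (tauP (a θ) (b θ) μ) (a θ * Complex.I) η₁ k x
      + expMode (tauM (a θ) (b θ) μ) (-(a θ * Complex.I)) η₁ k x)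
    (T := fun k x => K₂ k x + K₃ k x + K₄ k x)
    (fun k x => by simp only [H, gardnerTau]; ring) (fun k x => by simp only [K, K₁]; ring)
    (fun k => by
      refine ((isBigO_expMode ?_ _ _ k).add (isBigO_expMode ?_ _ _ k)).add
        (isBigO_expMode ?_ _ _ k)
      · filter_upwards [eventually_ge_atTop 0] with x hx
        simpa using mul_nonneg hβ.le hx
      · simp
      · simp)
    (fun k => by
      refine ((isBigO_expModeDot ?_ _ _ _ _ _ k).add (isBigO_expModeDot ?_ _ _ _ _ _ k)).add
        (isBigO_expModeDot ?_ _ _ _ _ _ k)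
      · filter_upwards [eventually_ge_atTop 0] with x hx
        simpa using mul_nonneg hβ.le hx
      · simp
      · simp)
    hH0θ
  -- At `-∞` the dominant coefficient is the constant `1/2`; hence `A' = 0`, and `S` tends to zero
  -- there.
  have bot := expTendsto_of_dominant_mode (l := atBot) (b := b θ) (ν := -b θ) hβ tendsto_abs_atBot_atTop
    (by filter_upwards [eventually_le_atBot 0] with x hx; rw [abs_of_nonpos hx]; ring)
    (A := 1 / 2) (by norm_num) (A' := 0) (ν' := -b') (η := η₂) (η' := η₂') (H := fun k => H k θ)
    (K := K)
    (R := fun k x => expMode (tauA (a θ) (b θ) μ) (b θ : ℂ) η₂ k x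
      + expMode (tauP (a θ) (b θ) μ) (a θ * Complex.I) η₁ k x
      + expMode (tauM (a θ) (b θ) μ) (-(a θ * Complex.I)) η₁ k x)
    (T := fun k x => K₁ k x + K₃ k x + K₄ k x)
    (fun k x => by simp only [H, gardnerTau]; push_cast; ring)
    (fun k x => by simp only [K, K₂]; push_cast; ring)
    (fun k => by
      refine ((isBigO_expMode ?_ _ _ k).add (isBigO_expMode ?_ _ _ k)).add
        (isBigO_expMode ?_ _ _ k)
      · filter_upwards [eventually_le_atBot 0] with x hx
        simpa using mul_nonpos_of_nonneg_of_nonpos hβ.le hx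
      · simp
      · simp)
    (fun k => by
      refine ((isBigO_expModeDot ?_ _ _ _ _ _ k).add (isBigO_expModeDot ?_ _ _ _ _ _ k)).add
        (isBigO_expModeDot ?_ _ _ _ _ _ k)
      · filter_upwards [eventually_le_atBot 0] with x hx
        simpa using mul_nonpos_of_nonneg_of_nonpos hβ.le hx
      · simp
      · simp)
    hH0θ
  have hT := breatherAsymptotics_of_expTendsto (R := fun k x => r k θ x) (ρ := ρ) top.1 top.2.1
  have hT' := breatherAsymptotics_of_expTendsto (R := fun k x => r k θ x) (ρ := ρ) bot.1 bot.2.1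
  have hτ : Tendsto (fun x => (K 0 x / H 0 θ x).im) atBot (𝓝 0) := by simpa using bot.2.2
  have hσ : Tendsto (fun x => (K 0 x / H 0 θ x).im) atTop
      (𝓝 (-2 * κ * (b' * D - b θ * (2 * a θ * a' + 2 * b θ * b')) / (D ^ 2 + 8 * μ ^ 2 * b θ ^ 2)))
      := by
    have h := top.2.2
    -- This is the `θ`-derivative of `arg A = -arctan (2κb/Δ)`.
    have e : (A' / tauA (a θ) (b θ) μ).im = -2 * κ * (b' * D - b θ * (2 * a θ * a' + 2 * b θ * b'))
        / (D ^ 2 + 8 * μ ^ 2 * b θ ^ 2) := by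
      rw [hAform, Complex.div_im, Complex.normSq_apply, hA']
      simp only [Complex.sub_re, Complex.sub_im, Complex.mul_re, Complex.mul_im, Complex.neg_re,
        Complex.neg_im, Complex.ofReal_re, Complex.ofReal_im, Complex.I_re, Complex.I_im]
      have h8 : 8 * μ ^ 2 * b θ ^ 2 = 4 * κ ^ 2 * b θ ^ 2 := by rw [hκ2]; ring
      rw [h8]
      have := hΔ.ne'
      have : D ^ 2 + 4 * κ ^ 2 * b θ ^ 2 ≠ 0 := by positivity
      have : (1 / 2 - (κ * b θ / D * 0 - 0 * 1)) * (1 / 2 - (κ * b θ / D * 0 - 0 * 1))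
          + (0 - (κ * b θ / D * 1 + 0 * 0)) * (0 - (κ * b θ / D * 1 + 0 * 0)) =
          (D ^ 2 + 4 * κ ^ 2 * b θ ^ 2) / (4 * D ^ 2) := by field_simp; ring
      rw [this]
      field_simp
      ring
    rwa [e] at h
  have hr : 0 < b θ / 2 := by positivity
  have flow' : BreatherFlow κ (b θ ^ 2 - a θ ^ 2) (a θ ^ 2 * b θ ^ 2) _ _ _ _ _ _ _ _ := flow
  obtain ⟨hint, hval⟩ := integral_mul_gardnerL flow' hB hr hT hT' hS hσ hτ
  have hQ := gardnerQ_eq_integral_mul_gardnerL flow' hB hr hT hT' hint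
  have hmem := (memH2_of_breatherFlow flow' hr hT hT' (2 * √2)).1
  rw [hze]
  refine ⟨fun x => (hzd x).differentiableAt, contDiff_const.mul flow'.contDiff_dp, hint, ?_, hQ,
    hmem⟩
  -- `M` is the value of `∫ B z = 8 ∫ p dp`, the jump of `2 (dq - κ S)` across the line; its last
  -- factor in the result, `4(a² + b²)(aa' + bb')`, is the `θ`-derivative of `(a² + b²)²`.
  rw [hval, hM]
  have hK0 : D ^ 2 + 8 * μ ^ 2 * b θ ^ 2 ≠ 0 := by positivity
  rw [← hκ]
  set X := (b' * D - b θ * (2 * a θ * a' + 2 * b θ * b')) / (D ^ 2 + 8 * μ ^ 2 * b θ ^ 2) with hX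
  rw [mul_div_assoc, mul_div_assoc, ← hX]
  unfold flowPrimitive flowEnergy flowD₁
  have hμ2 : μ ^ 2 = κ ^ 2 / 2 := by rw [hκ2]; ring
  rw [hμ2]
  ring

end

/-! ### Signs of the two values and conclusion. -/

theorem not_ae_eq_zero_of_integral_mul_ne_zero {z g : ℝ → ℝ} (h : ∫ x, z x * g x ≠ 0) :
    ¬ z =ᵐ[volume] 0 := by
  intro h0
  refine h (integral_eq_zero_of_ae ?_)
  filter_upwards [h0] with x hx
  simp [hx]

theorem gardnerDelta_pos {α β μ : ℝ} (hμ : 0 < μ) (hμ' : μ < gardnerMuMax α β) :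
    0 < gardnerDelta α β μ := by
  unfold gardnerMuMax at hμ'
  have h := (Real.lt_sqrt hμ.le).1 hμ'
  unfold gardnerDelta
  linarith

theorem scalingAlpha_value_pos {α β μ : ℝ} (hα : 0 < α) (hβ : 0 < β)
    (hΔ : 0 < gardnerDelta α β μ) :
    0 < 32 * α ^ 2 * β * (1 + 2 * μ ^ 2 * gardnerDelta α β μ /
      (gardnerDelta α β μ ^ 2 + 8 * μ ^ 2 * β ^ 2)) := by
  positivity

theorem scalingBeta_value_neg {α β μ : ℝ} (hα : 0 < α) (hβ : 0 < β)
    (hΔ : 0 < gardnerDelta α β μ) :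
    -16 * β * ((α ^ 2 - β ^ 2) + (α ^ 2 + β ^ 2 + 2 * μ ^ 2) *
      ((gardnerDelta α β μ ^ 2 + 2 * μ ^ 2 * gardnerDelta α β μ + 4 * μ ^ 2 * β ^ 2) /
        (gardnerDelta α β μ ^ 2 + 8 * μ ^ 2 * β ^ 2))) < 0 := by
  have hK : 0 < gardnerDelta α β μ ^ 2 + 8 * μ ^ 2 * β ^ 2 := by positivity
  -- Since `α² - β²` may be negative, the sign appears only over the common denominator, where every
  -- remaining term is positive.
  have e : (α ^ 2 - β ^ 2) + (α ^ 2 + β ^ 2 + 2 * μ ^ 2) *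
      ((gardnerDelta α β μ ^ 2 + 2 * μ ^ 2 * gardnerDelta α β μ + 4 * μ ^ 2 * β ^ 2) /
        (gardnerDelta α β μ ^ 2 + 8 * μ ^ 2 * β ^ 2)) =
      2 * α ^ 2 * ((α ^ 2 + β ^ 2) * gardnerDelta α β μ + 8 * μ ^ 2 * β ^ 2) /
        (gardnerDelta α β μ ^ 2 + 8 * μ ^ 2 * β ^ 2) := by
    field_simp
    unfold gardnerDelta
    ring
  rw [e]
  have : 0 < 2 * α ^ 2 * ((α ^ 2 + β ^ 2) * gardnerDelta α β μ + 8 * μ ^ 2 * β ^ 2) /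
        (gardnerDelta α β μ ^ 2 + 8 * μ ^ 2 * β ^ 2) := by positivity
  nlinarith [mul_pos hβ this]

end

theorem lemma5p5 (α β μ t x₁ x₂ : ℝ) (hα : 0 < α) (hβ : 0 < β)
    (hμ : 0 < μ) (hμ' : μ < gardnerMuMax α β) :
    ((∀ x, DifferentiableAt ℝ (fun a => gardnerBreather a β μ t x₁ x₂ x) α) ∧
      ContDiff ℝ ∞ (scalingAlpha α β μ t x₁ x₂) ∧
      Integrable (fun x => scalingAlpha α β μ t x₁ x₂ x *
        gardnerL α β μ t x₁ x₂ (scalingAlpha α β μ t x₁ x₂) x) ∧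
      (∫ x, scalingAlpha α β μ t x₁ x₂ x *
          gardnerL α β μ t x₁ x₂ (scalingAlpha α β μ t x₁ x₂) x) =
        32 * α ^ 2 * β * (1 + 2 * μ ^ 2 * gardnerDelta α β μ /
          (gardnerDelta α β μ ^ 2 + 8 * μ ^ 2 * β ^ 2)) ∧
      0 < 32 * α ^ 2 * β * (1 + 2 * μ ^ 2 * gardnerDelta α β μ /
          (gardnerDelta α β μ ^ 2 + 8 * μ ^ 2 * β ^ 2)) ∧
      gardnerQ α β μ t x₁ x₂ (scalingAlpha α β μ t x₁ x₂) =
        (∫ x, scalingAlpha α β μ t x₁ x₂ x *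
          gardnerL α β μ t x₁ x₂ (scalingAlpha α β μ t x₁ x₂) x) ∧
      IsPositiveDirection α β μ t x₁ x₂ (scalingAlpha α β μ t x₁ x₂)) ∧
    ((∀ x, DifferentiableAt ℝ (fun b => gardnerBreather α b μ t x₁ x₂ x) β) ∧
      ContDiff ℝ ∞ (scalingBeta α β μ t x₁ x₂) ∧
      Integrable (fun x => scalingBeta α β μ t x₁ x₂ x *
        gardnerL α β μ t x₁ x₂ (scalingBeta α β μ t x₁ x₂) x) ∧
      (∫ x, scalingBeta α β μ t x₁ x₂ x *
          gardnerL α β μ t x₁ x₂ (scalingBeta α β μ t x₁ x₂) x) =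
        -16 * β * ((α ^ 2 - β ^ 2) + (α ^ 2 + β ^ 2 + 2 * μ ^ 2) *
          ((gardnerDelta α β μ ^ 2 + 2 * μ ^ 2 * gardnerDelta α β μ + 4 * μ ^ 2 * β ^ 2) /
            (gardnerDelta α β μ ^ 2 + 8 * μ ^ 2 * β ^ 2))) ∧
      -16 * β * ((α ^ 2 - β ^ 2) + (α ^ 2 + β ^ 2 + 2 * μ ^ 2) *
          ((gardnerDelta α β μ ^ 2 + 2 * μ ^ 2 * gardnerDelta α β μ + 4 * μ ^ 2 * β ^ 2) /
            (gardnerDelta α β μ ^ 2 + 8 * μ ^ 2 * β ^ 2))) < 0 ∧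
      gardnerQ α β μ t x₁ x₂ (scalingBeta α β μ t x₁ x₂) =
        (∫ x, scalingBeta α β μ t x₁ x₂ x *
          gardnerL α β μ t x₁ x₂ (scalingBeta α β μ t x₁ x₂) x) ∧
      IsNegativeDirection α β μ t x₁ x₂ (scalingBeta α β μ t x₁ x₂)) := by
  have hΔ := gardnerDelta_pos hμ hμ'
  have hK : gardnerDelta α β μ ^ 2 + 8 * μ ^ 2 * β ^ 2 ≠ 0 := by positivity
  constructor
  · obtain ⟨h1, h2, h3, h4, h5, h6⟩ := gardner_scaling (a := fun s => s) (b := fun _ => β) (θ := α)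
      t x₁ x₂ (hasDerivAt_id' α) (hasDerivAt_const α β) hα hβ hΔ
      (z := scalingAlpha α β μ t x₁ x₂) rfl rfl
    have hval : (∫ x, scalingAlpha α β μ t x₁ x₂ x *
        gardnerL α β μ t x₁ x₂ (scalingAlpha α β μ t x₁ x₂) x) =
        32 * α ^ 2 * β * (1 + 2 * μ ^ 2 * gardnerDelta α β μ /
          (gardnerDelta α β μ ^ 2 + 8 * μ ^ 2 * β ^ 2)) := by
      -- With `a' = 1` and `b' = 0`, `M = -16μ²αβ / (Δ² + 8μ²β²)` and the value is `32α²β - 4αΔM`.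
      refine h4.trans ?_
      field_simp
      unfold gardnerDelta
      ring
    have hpos := scalingAlpha_value_pos hα hβ hΔ
    refine ⟨h1, h2, h3, hval, hpos, h5, h6, ?_, ?_⟩
    · exact not_ae_eq_zero_of_integral_mul_ne_zero (hval ▸ hpos.ne')
    · rw [h5, hval]; exact hpos
  · obtain ⟨h1, h2, h3, h4, h5, h6⟩ := gardner_scaling (a := fun _ => α) (b := fun s => s) (θ := β)
      t x₁ x₂ (hasDerivAt_const β α) (hasDerivAt_id' β) hα hβ hΔ
      (z := scalingBeta α β μ t x₁ x₂) rfl rfl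
    have hval : (∫ x, scalingBeta α β μ t x₁ x₂ x *
        gardnerL α β μ t x₁ x₂ (scalingBeta α β μ t x₁ x₂) x) =
        -16 * β * ((α ^ 2 - β ^ 2) + (α ^ 2 + β ^ 2 + 2 * μ ^ 2) *
          ((gardnerDelta α β μ ^ 2 + 2 * μ ^ 2 * gardnerDelta α β μ + 4 * μ ^ 2 * β ^ 2) /
            (gardnerDelta α β μ ^ 2 + 8 * μ ^ 2 * β ^ 2))) := by
      -- With `a' = 0` and `b' = 1`, the value is `-16β(α² - β²) - 4β(α² + β² + 2μ²)M`, and `M / 4`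
      -- is the fraction in the claim.
      refine h4.trans ?_
      field_simp
      unfold gardnerDelta
      ring
    have hneg := scalingBeta_value_neg hα hβ hΔ
    refine ⟨h1, h2, h3, hval, hneg, h5, h6, ?_, ?_⟩
    · exact not_ae_eq_zero_of_integral_mul_ne_zero (hval ▸ hneg.ne)
    · rw [h5, hval]; exact hneg
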